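/- **Model.** Let $\mathcal I$ be a finite set of customer types and let $\bar{\mathcal K}\subset\mathbb Z_+^{\mathcal I}$ be a finite set of feasible server configurations, such that $k\in\bar{\mathcal K}$, $k'\in\mathbb Z_+^{\mathcal I}$, $k'\le k$ imply $k'\in\bar{\mathcal K}$, and such that every unit vector $e_i$ is in $\bar{\mathcal K}$. Put $\mathcal K=\bar{\mathcal K}\setminus\{0\}$. There are infinitely many servers. Let $\lambda_i,\mu_i,\mu_0>0$, $\rho_i=\lambda_i/\mu_i$ with $\sum_i\rho_i=1$, and $p\in(\tfrac12,1)$. In the $r$-th open system ($r>0$) customers of type $i$ arrive as independent Poisson flows of rate $\lambda_i r$, and all service times are independent, exponential with mean $1/\mu_i$ for type $i$; each customer leaves after its service. **State.** Servers may contain actual customers and tokens. A complete configuration is a pair $(k,\hat k)$ with $k\in\mathcal K$, $\hat k\in\mathbb Z_+^{\mathcal I}$, $\hat k\le k$: $k_i$ is the number of type-$i$ customers and tokens in the server, $\hat k_i$ the number of actual type-$i$ customers. The state is $(X_{(k,\hat k)})$, the number of servers in each complete configuration. Put $X_k=\sum_{\hat k\le k}X_{(k,\hat k)}$ for $k\in\mathcal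 K$, $X_0=0$; let $\tilde Y_i$ be the number of type-$i$ tokens and $Z$ the total number of actual customers. **Placement rule GSS.** In a given state a customer or token of type $i$ is added to a server of some configuration $k$ with $k+e_i\in\mathcal K$, and $k=0$ or $X_k>0$, for which $w(X_{k+e_i})-w(X_k)$ is minimal, where $w(x)=1\wedge (x/Z^p)$ (if $Z=0$, all weights are taken to be $0$, so that any feasible placement is allowed). Ties, and the choice among servers of the same configuration $k$, are resolved arbitrarily (possibly at random), based on the current state. **Policy GSS-M.** When a type-$i$ service is completed, the customer is removed and a type-$i$ token is immediately placed by GSS in the resulting state. An arriving type-$i$ customer replaces an (arbitrarily chosen) existing type-$i$ token if there is one, and is placed by GSS otherwise. Each token that is not replaced leaves the system after an independent exponential time with mean $1/\mu_0$. The state is then a continuous-time Markov chain; the superscript $r$ and the argument $\infty$ denote the state of the $r$-th system in steady state, i.e. distributed according to a stationary distribution of this chain. Let $x^r_k(\infty)=X^r_k(\infty)/r$, $k\in\mathcal K$. **Linear program.** Let $\mathcal X^*$ be the set of optimal solutions of: minimize $\sum_{k\in\mathcal K}x_k$ subject to $\sum_{k\in\mathcal K}k_ix_k=\rho_i$ for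 all $i\in\mathcal I$, and $x_k\ge0$ for all $k\in\mathcal K$. Let $d(x,\mathcal X^*)=\inf_{u\in\mathcal X^*}\sum_k|x_k-u_k|$. **Theorem.** There is a constant $C>0$, not depending on $r$ nor on how the arbitrary choices are made, such that, for all versions of GSS-M (which may vary with $r$), in steady state, as $r\to\infty$ (along any sequence), $$\mathbb P\bigl(d(x^r(\infty),\mathcal X^*)\le C r^{p-1}\bigr)\to1 \qquad\text{and}\qquad r^{-p}\sum_i\tilde Y_i^r(\infty)\Longrightarrow 0 .$$ Consequently, fluid-scale asymptotic optimality holds: $$d(x^r(\infty),\mathcal X^*)\Longrightarrow0 \qquad\text{and}\qquad r^{-1}\sum_i\tilde Y_i^r(\infty)\Longrightarrow0 .$$ Here $\Longrightarrow$ denotes convergence in distribution. -/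

import Mathlib

open MeasureTheory Filter Topology

noncomputable section

namespace GSSPacking

/-- A pair `(k, k̂)`: `k` counts all customers (actual ones and tokens) of each type in a server,
`k̂` counts the actual customers only. -/
abbrev ServerConfig (I : Type*) := (I → ℕ) × (I → ℕ)

section Model

variable {I : Type*} [Fintype I] [DecidableEq I]

/-- The non-zero server configurations. Throughout, `K` is the set of all feasible
configurations, the zero configuration included. -/
def nonzeroConfigs (K : Finset (I → ℕ)) : Finset (I → ℕ) := K.filter (fun k => k ≠ 0)

/-- The pairs `(k, k̂)` with `k` feasible and `k̂ ≤ k`; this includes the idle server `(0, 0)`. -/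
def serverConfigs (K : Finset (I → ℕ)) : Finset (ServerConfig I) :=
  (K ×ˢ K).filter (fun c => ∀ i, c.2 i ≤ c.1 i)

/-- The complete server configurations: pairs `(k, k̂)` with `k` feasible, `k ≠ 0`, `k̂ ≤ k`. -/
def completeConfigs (K : Finset (I → ℕ)) : Finset (ServerConfig I) :=
  (serverConfigs K).filter (fun c => c.1 ≠ 0)

/-- A system state: the number `X (k, k̂)` of servers in each complete configuration. -/
abbrev State (K : Finset (I → ℕ)) := completeConfigs K → ℕ

/-- The number of servers in configuration `c`; it is `0` by convention if `c` is the idle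
configuration. -/
def count {K : Finset (I → ℕ)} (X : State K) (c : ServerConfig I) : ℕ :=
  if h : c ∈ completeConfigs K then X ⟨c, h⟩ else 0

/-- `X_k = ∑_{k̂ ≤ k} X_(k, k̂)`; in particular `X_0 = 0`. -/
def numServers {K : Finset (I → ℕ)} (X : State K) (k : I → ℕ) : ℕ :=
  ∑ c : completeConfigs K, if c.1.1 = k then X c else 0

/-- The number of actual customers of type `i`. -/
def numActual {K : Finset (I → ℕ)} (X : State K) (i : I) : ℕ :=
  ∑ c : completeConfigs K, c.1.2 i * X c

/-- The number of tokens of type `i`. -/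
def numTokens {K : Finset (I → ℕ)} (X : State K) (i : I) : ℕ :=
  ∑ c : completeConfigs K, (c.1.1 i - c.1.2 i) * X c

/-- The total number `Z` of actual customers. -/
def totalActual {K : Finset (I → ℕ)} (X : State K) : ℕ := ∑ i, numActual X i

/-- The state after one server passes from configuration `c` to configuration `c'`.
The idle configuration is not counted, so `c = 0` opens a server and `c' = 0` closes one. -/
def move {K : Finset (I → ℕ)} (X : State K) (c c' : ServerConfig I) : State K :=
  fun d => X d - (if d.1 = c then 1 else 0) + (if d.1 = c' then 1 else 0)

/-- The weight `1 ∧ (n / Z ^ p)`. If `Z = 0` every weight is `0`, so that all possible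
placements are then tied. -/
def weight (p : ℝ) (Z n : ℕ) : ℝ := min 1 ((n : ℝ) / (Z : ℝ) ^ p)

/-- The weight difference `w(X_{k + e_i}) - w(X_k)` caused by adding a customer of type `i`
to a server of configuration `k`. -/
def weightDiff {K : Finset (I → ℕ)} (p : ℝ) (X : State K) (k : I → ℕ) (i : I) : ℝ :=
  weight p (totalActual X) (numServers X (k + Pi.single i 1)) -
    weight p (totalActual X) (numServers X k)

/-- A customer (or token) of type `i` can be added to a server of configuration `c`: the result
is feasible, and `c` is either idle or present in the state. -/
def CanPlace {K : Finset (I → ℕ)} (X : State K) (i : I) (c : ServerConfig I) : Prop :=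
  c ∈ serverConfigs K ∧ c.1 + Pi.single i 1 ∈ K ∧ (c.1 = 0 ∨ 0 < count X c)

/-- The placements that the GSS rule permits: those which minimize the weight difference. -/
def IsGSSPlacement {K : Finset (I → ℕ)} (p : ℝ) (X : State K) (i : I) (c : ServerConfig I) :
    Prop :=
  CanPlace X i c ∧ ∀ c', CanPlace X i c' → weightDiff p X c.1 i ≤ weightDiff p X c'.1 i

/-- A server of configuration `c` is present and contains a token of type `i`. -/
def HoldsToken {K : Finset (I → ℕ)} (X : State K) (i : I) (c : ServerConfig I) : Prop :=
  0 < count X c ∧ c.2 i < c.1 i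

/-- A version of the policy GSS-M: an arbitrary (possibly random) state-dependent choice among the
placements permitted by GSS, for arriving customers and for new tokens, and an arbitrary
(possibly random) choice of the token to be replaced. -/
structure GSSMPolicy (K : Finset (I → ℕ)) (p : ℝ) where
  /-- law of the configuration of the server that receives an arriving customer -/
  placeCustomer : State K → I → PMF (ServerConfig I)
  /-- law of the configuration of the server that receives a new token -/
  placeToken : State K → I → PMF (ServerConfig I)
  /-- law of the configuration of the server in which a token is replaced -/
  replaceToken : State K → I → PMF (ServerConfig I)
  placeCustomer_gss : ∀ X i, ∀ c ∈ (placeCustomer X i).support, IsGSSPlacement p X i c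
  placeToken_gss : ∀ X i, ∀ c ∈ (placeToken X i).support, IsGSSPlacement p X i c
  replaceToken_holds : ∀ X i, 0 < numTokens X i →
    ∀ c ∈ (replaceToken X i).support, HoldsToken X i c

namespace GSSMPolicy

variable {K : Finset (I → ℕ)} {p : ℝ} (P : GSSMPolicy K p)

/-- Law of the state right after the arrival of a customer of type `i`: it replaces a token of its
type if there is one, and is placed by GSS otherwise. -/
def afterArrival (X : State K) (i : I) : PMF (State K) :=
  if 0 < numTokens X i then
    (P.replaceToken X i).map (fun c => move X c (c.1, c.2 + Pi.single i 1))
  else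
    (P.placeCustomer X i).map (fun c => move X c (c.1 + Pi.single i 1, c.2 + Pi.single i 1))

/-- Law of the state right after a token of type `i` is placed by GSS. -/
def afterTokenPlacement (X : State K) (i : I) : PMF (State K) :=
  (P.placeToken X i).map (fun c => move X c (c.1 + Pi.single i 1, c.2))

/-- Law of the state right after a service completion of type `i` in a server of configuration
`c`: the customer is removed, and then a token of type `i` is placed by GSS. -/
def afterService (X : State K) (c : ServerConfig I) (i : I) : PMF (State K) :=
  P.afterTokenPlacement (move X c (c.1 - Pi.single i 1, c.2 - Pi.single i 1)) i

/-- Law of the state right after a token of type `i` in a server of configuration `c` expires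
(a point mass). -/
def afterTimeout (X : State K) (c : ServerConfig I) (i : I) : PMF (State K) :=
  PMF.pure (move X c (c.1 - Pi.single i 1, c.2))

/-- The transition rate from `X` to `Y` in the `r`-th system: arrivals of type `i` at rate
`lam i * r`, services of type `i` at rate `mu i` per actual customer, expirations at rate `mu0`
per token. -/
def rate (lam mu : I → ℝ) (mu0 r : ℝ) (X Y : State K) : ENNReal :=
  ∑ i, (ENNReal.ofReal (lam i * r) * P.afterArrival X i Y
    + ∑ c : completeConfigs K,
        ENNReal.ofReal (mu i * (c.1.2 i : ℝ) * (X c : ℝ)) * P.afterService X c.1 i Y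
    + ∑ c : completeConfigs K,
        ENNReal.ofReal (mu0 * ((c.1.1 i : ℝ) - (c.1.2 i : ℝ)) * (X c : ℝ))
          * afterTimeout X c.1 i Y)

/-- The probability measure `π` is a stationary distribution of the Markov chain of the `r`-th
system: it solves the global balance equations (the chain does not explode, so these characterize
stationarity). The finite terms `π {Y} * rate Y Y` occur on both sides and cancel. -/
def IsStationary (lam mu : I → ℝ) (mu0 r : ℝ) (π : Measure (State K)) : Prop :=
  ∀ Y : State K,
    ∑' X : State K, π {X} * P.rate lam mu mu0 r X Y =
      π {Y} * ∑' X : State K, P.rate lam mu mu0 r Y X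

end GSSMPolicy

/-- The vectors indexed by the non-zero configurations, with the `1`-norm. -/
abbrev ConfigSpace (K : Finset (I → ℕ)) := PiLp 1 (fun _ : nonzeroConfigs K => ℝ)

/-- The feasible set of the linear program: minimize `∑ x_k` subject to `∑ k_i x_k = ρ_i` for all
`i`, and `x ≥ 0`. -/
def lpFeasible (K : Finset (I → ℕ)) (ρ : I → ℝ) : Set (ConfigSpace K) :=
  {x | (∀ k, 0 ≤ x k) ∧ ∀ i, ∑ k, (k.1 i : ℝ) * x k = ρ i}

/-- The set of optimal solutions of the linear program. -/
def lpOptimal (K : Finset (I → ℕ)) (ρ : I → ℝ) : Set (ConfigSpace K) :=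
  {x | x ∈ lpFeasible K ρ ∧ ∀ y ∈ lpFeasible K ρ, ∑ k, x k ≤ ∑ k, y k}

/-- The fluid-scaled state `x^r = (X_k / r)_k`. -/
def fluidState {K : Finset (I → ℕ)} (r : ℝ) (X : State K) : ConfigSpace K :=
  WithLp.toLp 1 (fun k => (numServers X k.1 : ℝ) / r)

/-- The `1`-norm distance from the fluid-scaled state to the set of optimal solutions. -/
def distToOptimal {K : Finset (I → ℕ)} (ρ : I → ℝ) (r : ℝ) (X : State K) : ℝ :=
  Metric.infDist (fluidState r X) (lpOptimal K ρ)

end Model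

end GSSPacking

end

open GSSPacking

/-! Write `T = r ^ p`. Up to the error of using `Z ^ p` instead of `T`, GSS descends greedily on
`potential`, the sum over `k` and `m < X_k` of `1 ∧ (m / T)`, because a placement changes it by a
weight difference. The Lyapunov function subtracts the number of customers and tokens, so that an
arrival costs nothing (it raises the potential by at most 1), and adds a quadratic penalty of size
`1 / √r` that holds customer counts near `ρ i * r` and token counts near 0.

A service followed by a greedy reinsertion raises the potential by at most `O(1/T + (|Z - r| +
1)/r)`, since returning the token to the vacated place is one of the options. The total service rate
is at most a constant times `Z`; after the penalty absorbs the squares, `√r ≤ T` (a use of `p >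
1/2`) leaves an error `O(√r)`.

The gain comes from LP duality. Let `ν i` be the least weight increase over available placements of
type `i`. Induction on the size of `k` gives `ν · k ≤ w k ≤ 1` (`dualValue_le_weight`), so `ν` is
dual feasible. If no bounded dual solution is tight on all saturated configurations, compactness
yields a saturated `k` with slack bounded below (`exists_dual_gap`). Descending from `k` one
customer at a time reaches a configuration of weight at least `κ`, hence with order `T` servers, in
which a service saves at least a fixed `ε` (`exists_improvable`). Unbalanced states thus have drift
of order `-T`, up to a multiple of the token count.

Foster's criterion in stationary form then bounds the mean squared deviation by `O(r)` and the
probability of imbalance by `O(r ^ (1/2 - p))` (`exists_stationary_bound`). In a balanced state with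
small deviation, loads are off by `O(T)`, unsaturated counts are at most `2 * T`, and the others are
complementary to a dual solution. Approximate complementary slackness with Hoffman's bound
(`exists_infDist_lpOptimal_le`) gives distance `O(T / r)` to the optimal set. -/

noncomputable section

namespace GSSPacking

set_option linter.unusedSectionVars false

open scoped ENNReal

/-! ### Stationary drift criterion and convergence to a constant -/

section Foster

/-- Foster's criterion in stationary form: global balance and a drift inequality, stated for the
finitely supported test functions `(N - f)⁺`, bound the stationary mean of `g`. -/
theorem lintegral_le_of_drift {S : Type*} [Countable S] [MeasurableSpace S]
    [MeasurableSingletonClass S] (π : Measure S) [IsProbabilityMeasure π] (q : S → S → ℝ≥0∞)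
    (hq : ∀ X, ∑' Y, q X Y ≠ ∞)
    (hπ : ∀ Y, ∑' X, π {X} * q X Y = π {Y} * ∑' X, q Y X)
    (f : S → ℝ) (hf : ∀ N : ℝ, {X | f X < N}.Finite) (g : S → ℝ≥0∞) (b : ℝ≥0∞)
    (hdrift : ∀ N X, f X < N → (∑' Y, q X Y) * ENNReal.ofReal (N - f X) + g X
      ≤ ∑' Y, q X Y * ENNReal.ofReal (N - f Y) + b) :
    ∫⁻ X, g X ∂π ≤ b := by
  have key : ∀ N : ℕ, ∑' X, π {X} * (if f X < N then g X else 0) ≤ b := by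
    intro N
    set h : S → ℝ≥0∞ := fun X => ENNReal.ofReal (N - f X) with hh
    have h0 : ∀ X, ¬ f X < N → h X = 0 := by
      intro X hX
      simp only [hh, ENNReal.ofReal_eq_zero]
      linarith
    -- Global balance tested against `h`; all terms are nonnegative, so the sums may be
    -- interchanged.
    have hA : ∑' X, π {X} * ∑' Y, q X Y * h Y = ∑' X, π {X} * ((∑' Y, q X Y) * h X) := by
      calc ∑' X, π {X} * ∑' Y, q X Y * h Y = ∑' X, ∑' Y, π {X} * q X Y * h Y := by
            simp only [← ENNReal.tsum_mul_left, mul_assoc]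
        _ = ∑' Y, ∑' X, π {X} * q X Y * h Y := ENNReal.tsum_comm
        _ = ∑' Y, (π {Y} * ∑' X, q Y X) * h Y := by
            simp only [ENNReal.tsum_mul_right, hπ]
        _ = _ := by simp only [mul_assoc]
    -- The finite support of `h` makes this finite without any integrability of `f`, which permits
    -- the cancellation at the end.
    have hfin : ∑' X, π {X} * ((∑' Y, q X Y) * h X) ≠ ∞ := by
      rw [tsum_eq_sum (s := (hf N).toFinset)]
      · refine ENNReal.sum_ne_top.2 fun X _ => ?_
        exact ENNReal.mul_ne_top (measure_ne_top _ _)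
          (ENNReal.mul_ne_top (hq X) ENNReal.ofReal_ne_top)
      · intro X hX
        rw [h0 X (by simpa using hX)]
        simp
    have hone : ∑' X, π {X} = 1 := by
      have := lintegral_countable' (μ := π) (fun _ => 1)
      simpa using this.symm
    have hsum : ∑' X, π {X} * ((∑' Y, q X Y) * h X)
          + ∑' X, π {X} * (if f X < N then g X else 0)
        ≤ ∑' X, π {X} * ((∑' Y, q X Y) * h X) + b := by
      calc _ = ∑' X, π {X} * ((∑' Y, q X Y) * h X + (if f X < N then g X else 0)) := by
            simp only [mul_add, ENNReal.tsum_add]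
        _ ≤ ∑' X, π {X} * (∑' Y, q X Y * h Y + b) := by
            refine ENNReal.tsum_le_tsum fun X => ?_
            refine mul_le_mul_right ?_ _
            by_cases hX : f X < N
            · simpa [hX] using hdrift N X hX
            · simp [hX, h0 X hX]
        _ = _ := by
            simp only [mul_add, ENNReal.tsum_add]
            rw [hA, ENNReal.tsum_mul_right, hone, one_mul]
    exact (ENNReal.add_le_add_iff_left hfin).1 hsum
  rw [lintegral_countable']
  rw [ENNReal.tsum_eq_iSup_sum]
  refine iSup_le fun s => ?_
  -- A finite set of states lies below some level `N`, so the truncated bound controls every finite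
  -- partial sum.
  obtain ⟨M, hM⟩ := (s.finite_toSet.image f).bddAbove
  obtain ⟨N, hN⟩ := exists_nat_gt M
  calc ∑ X ∈ s, g X * π {X} = ∑ X ∈ s, π {X} * (if f X < N then g X else 0) := by
        refine Finset.sum_congr rfl fun X hX => ?_
        rw [if_pos ((hM ⟨X, hX, rfl⟩).trans_lt hN), mul_comm]
    _ ≤ ∑' X, π {X} * (if f X < N then g X else 0) := ENNReal.sum_le_tsum _
    _ ≤ b := key N

/-- Convergence in probability to `0` on varying probability spaces gives convergence in
distribution to the constant `0`. -/
theorem tendstoInDistribution_zero {S : Type*} [MeasurableSpace S] (π : ℕ → Measure S)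
    [∀ n, IsProbabilityMeasure (π n)] (F : ℕ → S → ℝ) (hF : ∀ n, Measurable (F n))
    (h : ∀ ε > 0, Tendsto (fun n => π n {X | |F n X| ≤ ε}) atTop (𝓝 1)) :
    TendstoInDistribution F atTop (fun _ : Unit => (0 : ℝ)) π (Measure.dirac ()) := by
  refine ⟨fun n => (hF n).aemeasurable, by fun_prop, ?_⟩
  -- Portmanteau: only open sets containing 0 carry limiting mass, and each of them contains an
  -- interval around 0.
  refine tendsto_of_forall_isOpen_le_liminf' fun G hG => ?_
  simp only [ProbabilityMeasure.coe_mk]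
  by_cases h0 : (0 : ℝ) ∈ G
  · obtain ⟨ε, hε, hball⟩ := Metric.isOpen_iff.1 hG 0 h0
    refine prob_le_one.trans ?_
    rw [← (h (ε / 2) (by positivity)).liminf_eq]
    refine liminf_le_liminf (Eventually.of_forall fun n => ?_)
    rw [Measure.map_apply (hF n) hG.measurableSet]
    refine measure_mono fun X hX => hball ?_
    rw [Metric.mem_ball, dist_zero_right, Real.norm_eq_abs]
    exact lt_of_le_of_lt hX (by linarith)
  · rw [Measure.map_apply (by fun_prop) hG.measurableSet]
    simp [h0]

end Foster

/-! ### Hoffman's error bound -/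

section Hoffman

variable {ι J : Type*} [Fintype ι] [Fintype J]

/-- A linear map that is injective at `0` on a closed cone is bounded below on it. -/
theorem exists_norm_le_mul_norm_map (A : (ι → ℝ) →ₗ[ℝ] (J → ℝ)) (S : Set (ι → ℝ))
    (hS : IsClosed S) (hcone : ∀ c ∈ S, ∀ t : ℝ, 0 ≤ t → t • c ∈ S)
    (hker : ∀ c ∈ S, A c = 0 → c = 0) :
    ∃ C : ℝ, 0 < C ∧ ∀ c ∈ S, ‖c‖ ≤ C * ‖A c‖ := by
  have hA : Continuous A := A.continuous_of_finiteDimensional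
  have hcpt : IsCompact (S ∩ Metric.sphere 0 1) := (isCompact_sphere 0 1).inter_left hS
  have main : ∃ m : ℝ, 0 < m ∧ ∀ c ∈ S ∩ Metric.sphere 0 1, m ≤ ‖A c‖ := by
    rcases (S ∩ Metric.sphere (0 : ι → ℝ) 1).eq_empty_or_nonempty with h | h
    · exact ⟨1, one_pos, by simp [h]⟩
    · obtain ⟨c₀, hc₀, hmin⟩ := hcpt.exists_isMinOn h (f := fun c => ‖A c‖) (by fun_prop)
      refine ⟨‖A c₀‖, norm_pos_iff.2 fun h0 => ?_, fun c hc => hmin hc⟩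
      have := hker c₀ hc₀.1 h0
      have h1 := hc₀.2
      simp [this] at h1
  obtain ⟨m, hm, hmin⟩ := main
  refine ⟨m⁻¹, inv_pos.2 hm, fun c hc => ?_⟩
  rcases eq_or_ne c 0 with rfl | hne
  · simp
  have hpos : 0 < ‖c‖ := norm_pos_iff.2 hne
  have := hmin (‖c‖⁻¹ • c) ⟨hcone c hc _ (by positivity), by simp [norm_smul, hpos.ne']⟩
  rw [map_smul, norm_smul, norm_inv, norm_norm] at this
  rw [inv_mul_eq_div, le_div_iff₀ hm]
  rw [inv_mul_eq_div, le_div_iff₀ hpos] at this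
  linarith

/-- The vectors with the sign pattern `σ` (in the weak sense). -/
def signCone (σ : ι → SignType) : Set (ι → ℝ) :=
  {c | ∀ k, 0 ≤ c k * (σ k : ℝ) ∧ (σ k = 0 → c k = 0)}

theorem isClosed_signCone (σ : ι → SignType) : IsClosed (signCone σ) := by
  simp only [signCone, Set.ofPred_forall, Set.ofPred_and]
  refine isClosed_iInter fun k => (isClosed_le (by fun_prop) (by fun_prop)).inter ?_
  exact isClosed_iInter fun _ => isClosed_eq (by fun_prop) (by fun_prop)

/-- Hoffman's error bound for systems `A u = b`, `u ≥ 0`. -/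
theorem exists_hoffman_constant (A : (ι → ℝ) →ₗ[ℝ] (J → ℝ)) :
    ∃ C : ℝ, 0 < C ∧ ∀ x u₀ : ι → ℝ, (∀ k, 0 ≤ x k) → (∀ k, 0 ≤ u₀ k) →
      ∃ u : ι → ℝ, (∀ k, 0 ≤ u k) ∧ A u = A u₀ ∧ ‖x - u‖ ≤ C * ‖A x - A u₀‖ := by
  classical
  -- There are finitely many sign patterns, so the constants can be summed. Patterns whose cone
  -- meets the kernel get a dummy constant and never occur for the residual below.
  have hσ : ∀ σ : ι → SignType, ∃ C : ℝ, 0 < C ∧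
      ((∀ c ∈ signCone σ, A c = 0 → c = 0) → ∀ c ∈ signCone σ, ‖c‖ ≤ C * ‖A c‖) := by
    intro σ
    by_cases h : ∀ c ∈ signCone σ, A c = 0 → c = 0
    · obtain ⟨C, hC, hb⟩ := exists_norm_le_mul_norm_map A _ (isClosed_signCone σ) (by
        intro c hc t ht k
        refine ⟨?_, fun h0 => by simp [(hc k).2 h0]⟩
        have := mul_nonneg ht (hc k).1
        simpa [mul_assoc] using this) h
      exact ⟨C, hC, fun _ => hb⟩
    · exact ⟨1, one_pos, fun h' => absurd h' h⟩
  choose C hC hb using hσ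
  refine ⟨∑ σ, C σ, Finset.sum_pos (fun σ _ => hC σ) Finset.univ_nonempty, ?_⟩
  intro x u₀ hx hu₀
  have hA : Continuous A := A.continuous_of_finiteDimensional
  -- The box between `u₀` and `x` supplies compactness and keeps its points nonnegative. Its
  -- `ℓ¹`-nearest solution to `x` is the required `u`.
  set U : Set (ι → ℝ) := (Set.univ.pi fun k => Set.uIcc (u₀ k) (x k)) ∩ {u | A u = A u₀}
  have hU : IsCompact U :=
    (isCompact_univ_pi fun k => isCompact_uIcc).inter_right (isClosed_eq hA continuous_const)
  have hne : U.Nonempty := ⟨u₀, fun k _ => Set.left_mem_uIcc, rfl⟩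
  obtain ⟨u, ⟨hbox, hAu⟩, hmin⟩ :=
    hU.exists_isMinOn hne (f := fun u => ∑ k, |x k - u k|) (by fun_prop)
  have hbox' : ∀ k, u k ∈ Set.uIcc (u₀ k) (x k) := fun k => hbox k trivial
  refine ⟨u, fun k => ?_, hAu, ?_⟩
  · exact (le_min (hu₀ k) (hx k)).trans (hbox' k).1
  set σ : ι → SignType := fun k => SignType.sign (x k - u k) with hσdef
  have hmem : x - u ∈ signCone σ := by
    intro k
    refine ⟨?_, fun h => by simpa [hσdef, sign_eq_zero_iff] using h⟩
    simp only [Pi.sub_apply, hσdef, self_mul_sign]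
    positivity
  -- A nonzero kernel vector with the signs of `x - u` would allow a small step `u + t • c` that
  -- stays in `U` and shortens each `|x k - u k|` by `t * |c k|`, against minimality.
  have hker : ∀ c ∈ signCone σ, A c = 0 → c = 0 := by
    intro c hc hAc
    by_contra hne
    have hev : ∀ k, ∀ᶠ t : ℝ in 𝓝[>] 0, t * |c k| ≤ |x k - u k| := by
      intro k
      by_cases h0 : x k - u k = 0
      · have : c k = 0 := (hc k).2 (by simp [hσdef, h0])
        simp [this]
      · have : Tendsto (fun t : ℝ => t * |c k|) (𝓝[>] 0) (𝓝 (0 * |c k|)) :=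
          ((continuous_id.mul continuous_const).tendsto 0).mono_left nhdsWithin_le_nhds
        rw [zero_mul] at this
        exact (this.eventually_lt_const (abs_pos.2 h0)).mono fun _ h => h.le
    obtain ⟨t, hall, ht⟩ := ((eventually_all.2 hev).and self_mem_nhdsWithin).exists
    have ht : 0 < t := ht
    have habs : ∀ k, |x k - (u k + t * c k)| = |x k - u k| - t * |c k| ∧
        u k + t * c k ∈ Set.uIcc (u k) (x k) := by
      intro k
      have h1 := hc k
      have h2 := hall k
      rcases lt_trichotomy (x k - u k) 0 with h | h | h
      · have hs : σ k = -1 := by simp [hσdef, sign_neg h]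
        have hck : c k ≤ 0 := by simpa [hs] using h1.1
        rw [abs_of_neg h, abs_of_nonpos hck] at h2 ⊢
        refine ⟨?_, ?_⟩
        · rw [abs_of_nonpos (by linarith)]; ring
        · rw [Set.uIcc_of_ge (by linarith)]
          exact ⟨by linarith, by nlinarith⟩
      · have hck : c k = 0 := h1.2 (by simp [hσdef, h])
        simp [hck]
      · have hs : σ k = 1 := by simp [hσdef, sign_pos h]
        have hck : 0 ≤ c k := by simpa [hs] using h1.1
        rw [abs_of_pos h, abs_of_nonneg hck] at h2 ⊢
        refine ⟨?_, ?_⟩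
        · rw [abs_of_nonneg (by linarith)]; ring
        · rw [Set.uIcc_of_le (by linarith)]
          exact ⟨by nlinarith, by linarith⟩
    have hmem' : u + t • c ∈ U := by
      refine ⟨fun k _ => ?_, by simpa [hAc] using hAu⟩
      exact Set.uIcc_subset_uIcc (hbox' k) Set.right_mem_uIcc (habs k).2
    have hle : ∑ k, |x k - u k| ≤ ∑ k, |x k - (u k + t * c k)| := hmin hmem'
    simp only [fun k => (habs k).1, Finset.sum_sub_distrib, ← Finset.mul_sum] at hle
    obtain ⟨k, hk⟩ := Function.ne_iff.1 hne
    have : 0 < ∑ k, |c k| :=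
      Finset.sum_pos' (fun _ _ => abs_nonneg _) ⟨k, Finset.mem_univ _, abs_pos.2 hk⟩
    nlinarith
  have h := hb σ hker _ hmem
  rw [map_sub, hAu] at h
  refine h.trans ?_
  gcongr
  exact Finset.single_le_sum (fun σ _ => (hC σ).le) (Finset.mem_univ σ)

end Hoffman

/-! ### Dual certificates and improvable configurations -/

section LinearProgram

variable {I : Type*} [Fintype I] [DecidableEq I]

/-- The value `ν · k` of the configuration `k` under the dual variables `ν`. -/
def dualValue (ν : I → ℝ) (k : I → ℕ) : ℝ := ∑ i, (k i : ℝ) * ν i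

@[simp] theorem dualValue_zero (ν : I → ℝ) : dualValue ν (0 : I → ℕ) = 0 := by simp [dualValue]

theorem dualValue_add_single (ν : I → ℝ) (k : I → ℕ) (i : I) :
    dualValue ν (k + Pi.single i 1) = dualValue ν k + ν i := by
  simp [dualValue, add_mul, Finset.sum_add_distrib, Pi.single_apply]

theorem continuous_dualValue (k : I → ℕ) : Continuous fun ν : I → ℝ => dualValue ν k := by
  unfold dualValue; fun_prop

theorem sub_single_add_single {k : I → ℕ} {i : I} (h : 0 < k i) :
    k - Pi.single i 1 + Pi.single i 1 = k := by
  funext j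
  by_cases hj : j = i
  · subst hj; simp; omega
  · simp [hj]

theorem dualValue_sub_single (ν : I → ℝ) {k : I → ℕ} {i : I} (h : 0 < k i) :
    dualValue ν k = dualValue ν (k - Pi.single i 1) + ν i := by
  rw [← dualValue_add_single, sub_single_add_single h]

theorem sum_sub_single {k : I → ℕ} {i : I} (h : 0 < k i) :
    ∑ j, k j = ∑ j, (k - Pi.single i 1 : I → ℕ) j + 1 := by
  conv_lhs => rw [← sub_single_add_single h]
  simp [Finset.sum_add_distrib, Pi.single_apply]

theorem abs_dualValue_le {ν : I → ℝ} (hν : ∀ i, |ν i| ≤ 1) (k : I → ℕ) :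
    |dualValue ν k| ≤ ((∑ i, k i : ℕ) : ℝ) := by
  unfold dualValue
  push_cast
  refine (Finset.abs_sum_le_sum_abs _ _).trans (Finset.sum_le_sum fun i _ => ?_)
  rw [abs_mul, Nat.abs_cast]
  exact mul_le_of_le_one_right (Nat.cast_nonneg _) (hν i)

/-- The set `B` of configurations is complementary to a bounded feasible dual solution. -/
def HasDualCertificate (K : Finset (I → ℕ)) (B : Set (I → ℕ)) : Prop :=
  ∃ ν : I → ℝ, (∀ i, |ν i| ≤ 1) ∧ (∀ k ∈ K, dualValue ν k ≤ 1) ∧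
    ∀ k ∈ K, k ∈ B → dualValue ν k = 1

/-- Without a dual certificate, complementarity fails by a uniform amount. -/
theorem exists_dual_gap (K : Finset (I → ℕ)) :
    ∃ a : ℝ, 0 < a ∧ ∀ B ⊆ K, ¬ HasDualCertificate K (B : Set (I → ℕ)) →
      ∀ ν : I → ℝ, (∀ i, |ν i| ≤ 1) → (∀ k ∈ K, dualValue ν k ≤ 1) →
        ∃ k ∈ B, a ≤ 1 - dualValue ν k := by
  classical
  have h1 : ∀ B : Finset (I → ℕ), ∃ a : ℝ, 0 < a ∧ (B ⊆ K →
      ¬ HasDualCertificate K (B : Set (I → ℕ)) →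
      ∀ ν : I → ℝ, (∀ i, |ν i| ≤ 1) → (∀ k ∈ K, dualValue ν k ≤ 1) →
        ∃ k ∈ B, a ≤ 1 - dualValue ν k) := by
    intro B
    by_cases hB : B ⊆ K ∧ ¬ HasDualCertificate K (B : Set (I → ℕ))
    swap
    · exact ⟨1, one_pos, fun h h' => absurd ⟨h, h'⟩ hB⟩
    obtain ⟨hBK, hno⟩ := hB
    -- The bounded dual polytope. The total slack on `B` attains its minimum there, and a zero
    -- minimum would be a certificate.
    set D : Set (I → ℝ) := (Set.univ.pi fun _ => Set.Icc (-1) 1) ∩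
      ⋂ k ∈ K, {ν | dualValue ν k ≤ 1} with hD
    have hDmem : ∀ ν, ν ∈ D ↔ (∀ i, |ν i| ≤ 1) ∧ ∀ k ∈ K, dualValue ν k ≤ 1 := by
      intro ν; simp [hD, abs_le, Pi.le_def, forall_and]
    have hDc : IsCompact D := (isCompact_univ_pi fun _ => isCompact_Icc).inter_right
      (isClosed_biInter fun k _ => isClosed_le (continuous_dualValue k) continuous_const)
    have hne : D.Nonempty := ⟨0, (hDmem 0).2 ⟨by simp, by simp [dualValue]⟩⟩
    obtain ⟨ν₀, hν₀, hmin⟩ := hDc.exists_isMinOn hne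
      (f := fun ν => ∑ k ∈ B, (1 - dualValue ν k))
      (continuous_finsetSum _ fun k _ => continuous_const.sub (continuous_dualValue k)).continuousOn
    have hnn : ∀ ν ∈ D, ∀ k ∈ B, 0 ≤ 1 - dualValue ν k := fun ν hν k hk =>
      sub_nonneg.2 (((hDmem ν).1 hν).2 k (hBK hk))
    set m := ∑ k ∈ B, (1 - dualValue ν₀ k) with hm
    have hmpos : 0 < m := by
      refine lt_of_le_of_ne (Finset.sum_nonneg (hnn ν₀ hν₀)) fun h0 => hno ?_
      have hz := (Finset.sum_eq_zero_iff_of_nonneg (hnn ν₀ hν₀)).1 h0.symm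
      exact ⟨ν₀, ((hDmem _).1 hν₀).1, ((hDmem _).1 hν₀).2, fun k _ hk => by
        have := hz k hk; linarith⟩
    -- If every slack on `B` were below this value, their sum would be below the minimum `m`.
    refine ⟨m / (B.card + 1), by positivity, fun _ _ ν hν hf => ?_⟩
    by_contra! hcon
    have hνD := (hDmem ν).2 ⟨hν, hf⟩
    have h2 : m ≤ ∑ k ∈ B, (1 - dualValue ν k) := hmin hνD
    have h3 : ∑ k ∈ B, (1 - dualValue ν k) ≤ B.card • (m / (B.card + 1)) :=
      Finset.sum_le_card_nsmul _ _ _ fun k hk => (hcon k hk).le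
    have h4 : (B.card : ℝ) * (m / (B.card + 1)) < m := by
      rw [mul_div_assoc', div_lt_iff₀ (by positivity)]
      nlinarith
    rw [nsmul_eq_mul] at h3
    linarith
  choose a ha hgap using h1
  obtain ⟨B₀, -, hB₀⟩ := K.powerset.exists_min_image a ⟨∅, by simp⟩
  refine ⟨a B₀, ha B₀, fun B hB hno ν hν hf => ?_⟩
  obtain ⟨k, hk, hle⟩ := hgap B hB hno ν hν hf
  exact ⟨k, hk, (hB₀ B (by simpa using hB)).trans hle⟩

/-- If `ν_i` is at most the weight difference of every available placement, then `ν` is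
dominated by the weights. -/
theorem dualValue_le_weight {K : Finset (I → ℕ)}
    (hmono : ∀ k ∈ K, ∀ k' : I → ℕ, k' ≤ k → k' ∈ K)
    {w : (I → ℕ) → ℝ} (hw0 : w 0 = 0) (hw : ∀ k, 0 ≤ w k) {ν : I → ℝ}
    (hν : ∀ i j, j + Pi.single i 1 ∈ K → (j = 0 ∨ 0 < w j) → ν i ≤ w (j + Pi.single i 1) - w j) :
    ∀ (n : ℕ), ∀ k ∈ K, ∑ i, k i = n → dualValue ν k ≤ w k := by
  intro n
  induction n with
  | zero =>
    intro k _ hk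
    have : k = 0 := by
      funext i
      exact (Finset.sum_eq_zero_iff.1 hk) i (Finset.mem_univ _)
    simp [this, hw0]
  | succ n ih =>
    intro k hkK hk
    have hsub : ∀ i, 0 < k i → dualValue ν (k - Pi.single i 1) ≤ w (k - Pi.single i 1) := by
      intro i hi
      refine ih _ (hmono k hkK _ fun j => ?_) ?_
      · simp
      · have := sum_sub_single hi; omega
    -- If some `k - e_i` is available, the bound telescopes. Otherwise all `k - e_i` have weight
    -- zero, so `ν · k ≤ ν i` for each type present; averaging over the customers in `k` gives `n *
    -- (ν · k) ≤ 0`.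
    by_cases hex : ∃ i, 0 < k i ∧ (k - Pi.single i 1 = 0 ∨ 0 < w (k - Pi.single i 1))
    · obtain ⟨i, hi, hav⟩ := hex
      have h1 := hsub i hi
      have h2 := hν i (k - Pi.single i 1) (by rwa [sub_single_add_single hi]) hav
      rw [sub_single_add_single hi] at h2
      rw [dualValue_sub_single ν hi]
      linarith
    · push Not at hex
      have hle : ∀ i, (k i : ℝ) * (dualValue ν k - ν i) ≤ 0 := by
        intro i
        rcases Nat.eq_zero_or_pos (k i) with h0 | hi
        · simp [h0]
        · have h1 := hsub i hi
          have h2 := (hex i hi).2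
          have h3 := dualValue_sub_single ν hi
          exact mul_nonpos_of_nonneg_of_nonpos (Nat.cast_nonneg _) (by linarith)
      have hsum : ∑ i, (k i : ℝ) * (dualValue ν k - ν i) ≤ 0 :=
        Finset.sum_nonpos fun i _ => hle i
      simp only [mul_sub, Finset.sum_sub_distrib, ← Finset.sum_mul] at hsum
      have hc : (∑ i, (k i : ℝ)) = n + 1 := by exact_mod_cast hk
      rw [hc] at hsum
      have hsum' : (n : ℝ) * dualValue ν k ≤ 0 := by
        have : dualValue ν k = ∑ i, (k i : ℝ) * ν i := rfl
        linarith
      have hn : 0 < n := by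
        rcases Nat.eq_zero_or_pos n with h0 | h
        · exfalso
          subst h0
          have : ∃ i, 0 < k i := by
            by_contra! hall
            have : ∑ i, k i = 0 := Finset.sum_eq_zero fun i _ => Nat.le_zero.1 (hall i)
            omega
          obtain ⟨i, hi⟩ := this
          refine (hex i hi).1 ?_
          have h := sum_sub_single hi
          funext j
          exact (Finset.sum_eq_zero_iff.1 (show ∑ j, (k - Pi.single i 1 : I → ℕ) j = 0 by omega)) j
            (Finset.mem_univ _)
        · exact h
      have hn' : (0 : ℝ) < n := by exact_mod_cast hn
      have : dualValue ν k ≤ 0 := by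
        by_contra! hpos
        nlinarith
      exact this.trans (hw k)

/-- A configuration of substantial weight which violates complementarity lies above one from
which the removal of a customer decreases the weights by more than any available placement
increases them. -/
theorem exists_improvable_of_gap {K : Finset (I → ℕ)}
    (hmono : ∀ k ∈ K, ∀ k' : I → ℕ, k' ≤ k → k' ∈ K)
    {w : (I → ℕ) → ℝ} (hw0 : w 0 = 0) (hw : ∀ k, 0 ≤ w k) {ν : I → ℝ} {ε : ℝ} :
    ∀ (n : ℕ), ∀ k ∈ K, ∑ i, k i = n + 1 → (n + 1) * ε ≤ w k - dualValue ν k →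
      ∃ k' ∈ K, ∃ i, 0 < k' i ∧ w k / 2 ^ n ≤ w k' ∧
        ε ≤ w k' - w (k' - Pi.single i 1) - ν i := by
  intro n
  induction n with
  | zero =>
    intro k hkK hk hgap
    have : ∃ i, 0 < k i := by
      by_contra! hall
      have : ∑ i, k i = 0 := Finset.sum_eq_zero fun i _ => Nat.le_zero.1 (hall i)
      omega
    obtain ⟨i, hi⟩ := this
    have hz : k - Pi.single i 1 = 0 := by
      have h := sum_sub_single hi
      funext j
      exact (Finset.sum_eq_zero_iff.1 (show ∑ j, (k - Pi.single i 1 : I → ℕ) j = 0 by omega)) j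
        (Finset.mem_univ _)
    refine ⟨k, hkK, i, hi, by simp, ?_⟩
    rw [dualValue_sub_single ν hi, hz] at hgap
    rw [hz, hw0]
    simp at hgap
    linarith
  | succ n ih =>
    intro k hkK hk hgap
    by_cases hex : ∃ i, 0 < k i ∧ ε ≤ w k - w (k - Pi.single i 1) - ν i
    · obtain ⟨i, hi, h⟩ := hex
      refine ⟨k, hkK, i, hi, ?_, h⟩
      exact div_le_self (hw k) (one_le_pow₀ (by norm_num))
    push Not at hex
    have hc : (∑ i, (k i : ℝ)) = n + 2 := by
      have : ((∑ i, k i : ℕ) : ℝ) = ((n + 1 + 1 : ℕ) : ℝ) := by rw [hk]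
      push_cast at this
      linarith
    -- Some customer has a price no larger than the average over the `n + 2` customers in `k`.
    -- Removing this one keeps the weight under control.
    have hmin : ∃ i, 0 < k i ∧ (n + 2) * ν i ≤ dualValue ν k := by
      by_contra! hall
      have hlt : ∑ i, (k i : ℝ) * dualValue ν k < ∑ i, (k i : ℝ) * ((n + 2) * ν i) := by
        refine Finset.sum_lt_sum (fun i _ => ?_) ?_
        · rcases Nat.eq_zero_or_pos (k i) with h0 | hi
          · simp [h0]
          · exact mul_le_mul_of_nonneg_left (hall i hi).le (Nat.cast_nonneg _)
        · have : ∃ i, 0 < k i := by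
            by_contra! hall
            have : ∑ i, k i = 0 := Finset.sum_eq_zero fun i _ => Nat.le_zero.1 (hall i)
            omega
          obtain ⟨i, hi⟩ := this
          exact ⟨i, Finset.mem_univ _,
            mul_lt_mul_of_pos_left (hall i hi) (by exact_mod_cast hi)⟩
      rw [← Finset.sum_mul, hc] at hlt
      have : ∑ i, (k i : ℝ) * ((n + 2) * ν i) = (n + 2) * dualValue ν k := by
        rw [dualValue, Finset.mul_sum]
        exact Finset.sum_congr rfl fun i _ => by ring
      linarith
    obtain ⟨i, hi, hle⟩ := hmin
    have h1 := hex i hi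
    have h2 := dualValue_sub_single ν hi
    have hwk := hw k
    push_cast at hgap
    have hn : (0 : ℝ) ≤ n := Nat.cast_nonneg n
    -- The removal loses less than `ν i + ε`, hence at most half of the weight, while the gap
    -- shrinks by at most `ε`. This is the source of the factor `2 ^ n`.
    have hν' : ν i + ε ≤ w k / 2 := by
      have : (n + 2 : ℝ) * (ν i + ε) ≤ (n + 2) * (w k / 2) := by nlinarith
      exact le_of_mul_le_mul_left this (by positivity)
    obtain ⟨k', hk', i', hi', hw', hε⟩ := ih (k - Pi.single i 1)
      (hmono k hkK _ fun j => by simp)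
      (by have := sum_sub_single hi; omega) (by nlinarith)
    refine ⟨k', hk', i', hi', le_trans ?_ hw', hε⟩
    rw [pow_succ, mul_comm, ← div_div]
    gcongr
    linarith

/-- The combinatorial core of the drift estimate. -/
theorem exists_improvable (K : Finset (I → ℕ))
    (hmono : ∀ k ∈ K, ∀ k' : I → ℕ, k' ≤ k → k' ∈ K) :
    ∃ ε κ : ℝ, 0 < ε ∧ 0 < κ ∧ ∀ (w : (I → ℕ) → ℝ) (ν : I → ℝ), w 0 = 0 → (∀ k, 0 ≤ w k) →
      (∀ k, w k ≤ 1) → (∀ i, |ν i| ≤ 1) →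
      (∀ i j, j + Pi.single i 1 ∈ K → (j = 0 ∨ 0 < w j) →
        ν i ≤ w (j + Pi.single i 1) - w j) →
      ¬ HasDualCertificate K {k | w k = 1} →
      ∃ k ∈ K, ∃ i, 0 < k i ∧ κ ≤ w k ∧ ε ≤ w k - w (k - Pi.single i 1) - ν i := by
  classical
  obtain ⟨a, ha, hgap⟩ := exists_dual_gap K
  obtain ⟨M, hM⟩ : ∃ M : ℕ, ∀ k ∈ K, ∑ i, k i ≤ M :=
    ⟨K.sup fun k => ∑ i, k i, fun k hk => Finset.le_sup (f := fun k => ∑ i, k i) hk⟩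
  -- The slack `a` is shared among at most `M` removals, and the initial weight 1 is halved at most
  -- `M` times.
  refine ⟨a / (M + 1), 1 / 2 ^ M, by positivity, by positivity, ?_⟩
  intro w ν hw0 hw hw1 hν hav hno
  have hdom := fun k hk => dualValue_le_weight hmono hw0 hw hav _ k hk rfl
  obtain ⟨k, hk, hle⟩ := hgap (K.filter fun k => w k = 1) (Finset.filter_subset _ _)
    (by
      rintro ⟨ν', h1, h2, h3⟩
      exact hno ⟨ν', h1, h2, fun k hk hw => h3 k hk (by simpa using ⟨hk, hw⟩)⟩)
    ν hν (fun k hk => (hdom k hk).trans (hw1 k))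
  obtain ⟨hkK, hwk⟩ := Finset.mem_filter.1 hk
  have hne : ∑ i, k i ≠ 0 := by
    intro h0
    have : k = 0 := by
      funext i
      exact (Finset.sum_eq_zero_iff.1 h0) i (Finset.mem_univ _)
    rw [this, hw0] at hwk
    norm_num at hwk
  obtain ⟨n, hn⟩ := Nat.exists_eq_succ_of_ne_zero hne
  have hnM : n + 1 ≤ M := by have := hM k hkK; omega
  have hnM' : (n : ℝ) + 1 ≤ M := by exact_mod_cast hnM
  obtain ⟨k', hk', i, hi, hw', hε⟩ := exists_improvable_of_gap hmono hw0 hw (ν := ν)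
    (ε := a / (M + 1)) n k hkK hn (by
      rw [hwk]
      refine le_trans ?_ hle
      rw [mul_div_assoc', div_le_iff₀ (by positivity)]
      nlinarith)
  refine ⟨k', hk', i, hi, le_trans ?_ hw', hε⟩
  rw [hwk]
  exact one_div_le_one_div_of_le (by positivity) (pow_le_pow_right₀ (by norm_num) (by omega))

end LinearProgram

/-! ### Stability of the linear program -/

section LinearProgramStability

variable {I : Type*} [Fintype I] [DecidableEq I]

/-- The constraint map `x ↦ (∑ k_i x_k)_i` of the linear program. -/
def loadMap (K : Finset (I → ℕ)) : (nonzeroConfigs K → ℝ) →ₗ[ℝ] (I → ℝ) where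
  toFun x i := ∑ k, (k.1 i : ℝ) * x k
  map_add' x y := by funext i; simp [mul_add, Finset.sum_add_distrib]
  map_smul' c x := by
    funext i
    simp only [Pi.smul_apply, smul_eq_mul, RingHom.id_apply, Finset.mul_sum]
    exact Finset.sum_congr rfl fun k _ => by ring

/-- The constraint map of the linear program together with its objective. -/
def loadObjectiveMap (K : Finset (I → ℕ)) : (nonzeroConfigs K → ℝ) →ₗ[ℝ] (Option I → ℝ) where
  toFun x o := o.elim (∑ k, x k) (loadMap K x)
  map_add' x y := by
    funext o
    cases o
    · simp [Finset.sum_add_distrib]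
    · simp
  map_smul' c x := by
    funext o
    cases o
    · simp [Finset.mul_sum]
    · simp

theorem single_mem_nonzeroConfigs {K : Finset (I → ℕ)}
    (hunit : ∀ i : I, (Pi.single i 1 : I → ℕ) ∈ K) (i : I) :
    (Pi.single i 1 : I → ℕ) ∈ nonzeroConfigs K := by
  simp [nonzeroConfigs, hunit]

/-- The linear program has an optimal solution. -/
theorem lpOptimal_nonempty {K : Finset (I → ℕ)}
    (hunit : ∀ i : I, (Pi.single i 1 : I → ℕ) ∈ K) {ρ : I → ℝ} (hρ : ∀ i, 0 ≤ ρ i) :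
    ∃ u : nonzeroConfigs K → ℝ, (∀ k, 0 ≤ u k) ∧ loadMap K u = ρ ∧
      ∀ v : nonzeroConfigs K → ℝ, (∀ k, 0 ≤ v k) → loadMap K v = ρ → ∑ k, u k ≤ ∑ k, v k := by
  -- The feasible point that serves each customer alone. Its objective value bounds the box in which
  -- a minimizer is sought.
  set v₀ : nonzeroConfigs K → ℝ := fun k => ∑ i, if k.1 = Pi.single i 1 then ρ i else 0 with hv₀
  have hv₀nn : ∀ k, 0 ≤ v₀ k := fun k =>
    Finset.sum_nonneg fun i _ => by split_ifs <;> simp [hρ]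
  have hv₀A : loadMap K v₀ = ρ := by
    funext j
    simp only [loadMap, LinearMap.coe_mk, AddHom.coe_mk, hv₀, Finset.mul_sum]
    rw [Finset.sum_comm]
    have : ∀ i, ∑ k : nonzeroConfigs K,
        ((k.1 j : ℝ) * if k.1 = Pi.single i 1 then ρ i else 0) = if j = i then ρ i else 0 := by
      intro i
      rw [Finset.sum_eq_single ⟨Pi.single i 1, single_mem_nonzeroConfigs hunit i⟩]
      · simp [Pi.single_apply]
      · intro k _ hk
        rw [if_neg (fun h => hk (Subtype.ext h)), mul_zero]
      · simp
    simp only [this]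
    simp
  set S : Set (nonzeroConfigs K → ℝ) := (Set.univ.pi fun _ => Set.Icc 0 (∑ k, v₀ k)) ∩
    {v | loadMap K v = ρ} with hS
  have hScpt : IsCompact S := (isCompact_univ_pi fun _ => isCompact_Icc).inter_right
    (isClosed_eq (loadMap K).continuous_of_finiteDimensional continuous_const)
  have hSne : S.Nonempty := ⟨v₀, fun k _ => ⟨hv₀nn k,
    Finset.single_le_sum (fun k _ => hv₀nn k) (Finset.mem_univ k)⟩, hv₀A⟩
  obtain ⟨u, ⟨hbox, hA⟩, hmin⟩ := hScpt.exists_isMinOn hSne (f := fun v => ∑ k, v k) (by fun_prop)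
  refine ⟨u, fun k => (hbox k trivial).1, hA, fun v hv hvA => ?_⟩
  by_cases hle : ∑ k, v k ≤ ∑ k, v₀ k
  · exact hmin (a := v) ⟨fun k _ => ⟨hv k,
      (Finset.single_le_sum (fun k _ => hv k) (Finset.mem_univ k)).trans hle⟩, hvA⟩
  · have h1 : ∑ k, u k ≤ ∑ k, v₀ k := hmin (a := v₀) ⟨fun k _ => ⟨hv₀nn k,
      Finset.single_le_sum (fun k _ => hv₀nn k) (Finset.mem_univ k)⟩, hv₀A⟩
    linarith

theorem sum_mul_dualValue (K : Finset (I → ℕ)) (ν : I → ℝ) (x : nonzeroConfigs K → ℝ) :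
    ∑ k, x k * dualValue ν k.1 = ∑ i, ν i * loadMap K x i := by
  simp only [dualValue, loadMap, LinearMap.coe_mk, AddHom.coe_mk, Finset.mul_sum]
  rw [Finset.sum_comm]
  exact Finset.sum_congr rfl fun i _ => Finset.sum_congr rfl fun k _ => by ring

theorem sum_sub_le_card_mul_norm {ι : Type*} [Fintype ι] (x u : ι → ℝ) :
    ∑ k, |x k - u k| ≤ Fintype.card ι * ‖x - u‖ := by
  have := Finset.sum_le_card_nsmul Finset.univ (fun k => |x k - u k|) ‖x - u‖
    fun k _ => norm_le_pi_norm (x - u) k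
  simpa using this

/-- A nearly feasible point whose large components are complementary to a dual certificate is
close to the set of optimal solutions. -/
theorem exists_infDist_lpOptimal_le {K : Finset (I → ℕ)}
    (hunit : ∀ i : I, (Pi.single i 1 : I → ℕ) ∈ K) {ρ : I → ℝ} (hρ : ∀ i, 0 ≤ ρ i) :
    ∃ C : ℝ, 0 < C ∧ ∀ (x : nonzeroConfigs K → ℝ) (β : ℝ), 0 ≤ β → (∀ k, 0 ≤ x k) →
      (∀ i, |∑ k, (k.1 i : ℝ) * x k - ρ i| ≤ β) →
      ∀ B : Set (I → ℕ), HasDualCertificate K B → (∀ k, k.1 ∉ B → x k ≤ β) →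
      Metric.infDist (WithLp.toLp 1 x) (lpOptimal K ρ) ≤ C * β := by
  obtain ⟨u₀, hu₀, hu₀A, hopt⟩ := lpOptimal_nonempty hunit hρ
  obtain ⟨C₁, hC₁, hH₁⟩ := exists_hoffman_constant (loadMap K)
  obtain ⟨C₂, hC₂, hH₂⟩ := exists_hoffman_constant (loadObjectiveMap K)
  obtain ⟨M, hM⟩ : ∃ M : ℕ, ∀ k ∈ K, ∑ i, k i ≤ M :=
    ⟨K.sup fun k => ∑ i, k i, fun k hk => Finset.le_sup (f := fun k => ∑ i, k i) hk⟩
  set n : ℝ := (Fintype.card (nonzeroConfigs K) : ℝ) with hn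
  have hn0 : 0 ≤ n := Nat.cast_nonneg _
  set D : ℝ := Fintype.card I + n * (1 + M) + n * C₁ + 1 with hD
  have hD1 : 1 ≤ D := by
    rw [hD]
    have : (0 : ℝ) ≤ Fintype.card I + n * (1 + M) + n * C₁ := by positivity
    linarith
  refine ⟨n * C₂ * D + 1, by positivity, ?_⟩
  intro x β hβ hx hload B ⟨ν, hν1, hνf, hνB⟩ hsmall
  have hloadnorm : ‖loadMap K x - loadMap K u₀‖ ≤ β := by
    rw [pi_norm_le_iff_of_nonneg hβ]
    intro i
    rw [hu₀A]
    exact hload i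
  -- Hoffman's bound for the load constraints alone moves `x` to a feasible point, whose objective
  -- is at least the optimum.
  have hlower : ∑ k, u₀ k - ∑ k, x k ≤ n * C₁ * β := by
    obtain ⟨u, hu, huA, hdist⟩ := hH₁ x u₀ hx hu₀
    have h1 := hopt u hu (huA.trans hu₀A)
    have h2 : ∑ k, u k - ∑ k, x k ≤ ∑ k, |x k - u k| := by
      rw [← Finset.sum_sub_distrib]
      exact Finset.sum_le_sum fun k _ => by rw [abs_sub_comm]; exact le_abs_self _
    have h3 := sum_sub_le_card_mul_norm x u
    have h4 : n * ‖x - u‖ ≤ n * (C₁ * β) := by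
      gcongr
      exact hdist.trans (by gcongr)
    linarith
  -- Approximate complementary slackness: components in `B` have price exactly 1, the others are at
  -- most `β`, and weak duality bounds the price of `u₀` by its objective.
  have hupper : ∑ k, x k - ∑ k, u₀ k ≤ (Fintype.card I + n * (1 + M)) * β := by
    have h1 : ∑ k, x k * dualValue ν k.1 - ∑ k, u₀ k * dualValue ν k.1
        ≤ Fintype.card I * β := by
      rw [sum_mul_dualValue, sum_mul_dualValue, ← Finset.sum_sub_distrib]
      have := Finset.sum_le_card_nsmul Finset.univ
        (fun i => ν i * loadMap K x i - ν i * loadMap K u₀ i) β fun i _ => by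
          rw [← mul_sub, hu₀A]
          refine (le_abs_self _).trans ?_
          rw [abs_mul]
          have h := hload i
          calc |ν i| * |loadMap K x i - ρ i| ≤ 1 * β :=
                mul_le_mul (hν1 i) h (abs_nonneg _) zero_le_one
            _ = β := one_mul β
      simpa using this
    have h2 : ∑ k, u₀ k * dualValue ν k.1 ≤ ∑ k, u₀ k := Finset.sum_le_sum fun k _ =>
      mul_le_of_le_one_right (hu₀ k) (hνf k.1 (Finset.mem_filter.1 k.2).1)
    have h3 : ∑ k, x k - ∑ k, x k * dualValue ν k.1 ≤ n * ((1 + M) * β) := by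
      rw [← Finset.sum_sub_distrib]
      have := Finset.sum_le_card_nsmul Finset.univ
        (fun k : nonzeroConfigs K => x k - x k * dualValue ν k.1) ((1 + M) * β) fun k _ => by
          have hkK := (Finset.mem_filter.1 k.2).1
          by_cases hkB : k.1 ∈ B
          · simp only [hνB k.1 hkK hkB, mul_one, sub_self]
            positivity
          · have ha := abs_le.1 (abs_dualValue_le hν1 k.1)
            have hm : ((∑ i, k.1 i : ℕ) : ℝ) ≤ M := by exact_mod_cast hM k.1 hkK
            have hb := hsmall k hkB
            calc x k - x k * dualValue ν k.1 = (1 - dualValue ν k.1) * x k := by ring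
              _ ≤ (1 + M) * β := mul_le_mul (by linarith [ha.1]) hb (hx k) (by positivity)
      rwa [Finset.card_univ, nsmul_eq_mul] at this
    linarith
  -- Prescribing the objective as well as the loads makes the nearby point optimal.
  obtain ⟨u, hu, huA, hdist⟩ := hH₂ x u₀ hx hu₀
  have huobj : ∑ k, u k = ∑ k, u₀ k := congrFun huA none
  have huload : loadMap K u = ρ := by
    rw [← hu₀A]
    funext i
    exact congrFun huA (some i)
  have humem : WithLp.toLp 1 u ∈ lpOptimal K ρ := by
    refine ⟨⟨hu, fun i => congrFun huload i⟩, fun y hy => ?_⟩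
    calc ∑ k, u k = ∑ k, u₀ k := huobj
      _ ≤ ∑ k, y k := hopt (fun k => y k) hy.1 (funext hy.2)
  have hAB : ‖loadObjectiveMap K x - loadObjectiveMap K u₀‖ ≤ D * β := by
    rw [pi_norm_le_iff_of_nonneg (by positivity)]
    intro o
    cases o with
    | none =>
      change |∑ k, x k - ∑ k, u₀ k| ≤ D * β
      rw [abs_le, hD]
      have e1 : 0 ≤ n * C₁ * β := by positivity
      have e2 : 0 ≤ (Fintype.card I + n * (1 + M)) * β := by positivity
      constructor <;> nlinarith
    | some i =>
      refine (norm_le_pi_norm (loadMap K x - loadMap K u₀) i).trans (hloadnorm.trans ?_)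
      nlinarith
  refine (Metric.infDist_le_dist_of_mem humem).trans ?_
  rw [dist_eq_norm, PiLp.norm_eq_of_L1]
  refine (sum_sub_le_card_mul_norm x u).trans ?_
  calc n * ‖x - u‖ ≤ n * (C₂ * (D * β)) := by
        gcongr
        exact hdist.trans (by gcongr)
    _ ≤ (n * C₂ * D + 1) * β := by nlinarith

end LinearProgramStability

/-! ### Drift criterion in terms of events -/

section EventDrift

open scoped ENNReal

theorem le_tsum_mul_of_forall_support {S : Type*} (Q : PMF S) (φ : S → ℝ≥0∞) (m : ℝ≥0∞)
    (h : ∀ Y ∈ Q.support, m ≤ φ Y) : m ≤ ∑' Y, Q Y * φ Y := by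
  calc m = ∑' Y, Q Y * m := by rw [ENNReal.tsum_mul_right, Q.tsum_coe, one_mul]
    _ ≤ _ := ENNReal.tsum_le_tsum fun Y => by
      by_cases hY : Q Y = 0
      · simp [hY]
      · exact mul_le_mul_right (h Y ((Q.mem_support_iff Y).2 hY)) _

/-- Foster's criterion for a chain whose transitions are a finite family of random events, with
the increments of the Lyapunov function bounded event by event. -/
theorem lintegral_le_of_event_drift {S : Type*} [Countable S] [MeasurableSpace S]
    [MeasurableSingletonClass S] (π : Measure S) [IsProbabilityMeasure π]
    {E : Type*} [Fintype E] (a : S → E → ℝ) (ha : ∀ X e, 0 ≤ a X e) (Q : S → E → PMF S)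
    (hπ : ∀ Y, ∑' X, π {X} * (∑ e, ENNReal.ofReal (a X e) * Q X e Y) =
      π {Y} * ∑' X, ∑ e, ENNReal.ofReal (a Y e) * Q Y e X)
    (f : S → ℝ) (hf : ∀ N : ℝ, {X | f X < N}.Finite) (s : S → E → ℝ)
    (hs : ∀ X e, a X e ≠ 0 → ∀ Y ∈ (Q X e).support, f Y ≤ f X + s X e)
    (g : S → ℝ) (hg : ∀ X, 0 ≤ g X) (b : ℝ)
    (hdrift : ∀ X, ∑ e, a X e * s X e + g X ≤ b) :
    ∫⁻ X, ENNReal.ofReal (g X) ∂π ≤ ENNReal.ofReal b := by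
  have hexp : ∀ (X : S) (φ : S → ℝ≥0∞), ∑' Y, (∑ e, ENNReal.ofReal (a X e) * Q X e Y) * φ Y
      = ∑ e, ENNReal.ofReal (a X e) * ∑' Y, Q X e Y * φ Y := by
    intro X φ
    simp only [Finset.sum_mul]
    rw [Summable.tsum_finsetSum (fun _ _ => ENNReal.summable)]
    simp only [mul_assoc, ENNReal.tsum_mul_left]
  have htot : ∀ X, ∑' Y, (∑ e, ENNReal.ofReal (a X e) * Q X e Y)
      = ∑ e, ENNReal.ofReal (a X e) := by
    intro X
    have := hexp X (fun _ => 1)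
    simpa [PMF.tsum_coe] using this
  refine lintegral_le_of_drift π _ ?_ hπ f hf _ _ ?_
  · intro X
    rw [htot]
    exact ENNReal.sum_ne_top.2 fun e _ => ENNReal.ofReal_ne_top
  intro N X hX
  rw [htot, hexp]
  have hD : 0 ≤ N - f X := by linarith
  have hb0 : (∑ e, a X e) * (N - f X) + g X ≤ ∑ e, a X e * (N - f X - s X e) + b := by
    have := hdrift X
    simp only [mul_sub, Finset.sum_sub_distrib, Finset.sum_mul] at this ⊢
    linarith
  calc (∑ e, ENNReal.ofReal (a X e)) * ENNReal.ofReal (N - f X) + ENNReal.ofReal (g X)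
      = ENNReal.ofReal ((∑ e, a X e) * (N - f X) + g X) := by
        rw [ENNReal.ofReal_add (mul_nonneg (Finset.sum_nonneg fun e _ => ha X e) hD) (hg X),
          ENNReal.ofReal_mul (Finset.sum_nonneg fun e _ => ha X e),
          ENNReal.ofReal_sum_of_nonneg fun e _ => ha X e]
    -- Taking positive parts only enlarges the right-hand side, so increments of either sign are
    -- compatible with the truncated test function.
    _ ≤ ENNReal.ofReal (∑ e, a X e * max (N - f X - s X e) 0 + b) := by
        refine ENNReal.ofReal_le_ofReal (hb0.trans ?_)
        gcongr with e
        · exact ha X e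
        · exact le_max_left _ _
    _ ≤ ENNReal.ofReal (∑ e, a X e * max (N - f X - s X e) 0) + ENNReal.ofReal b :=
        ENNReal.ofReal_add_le
    _ ≤ _ := by
        gcongr
        rw [ENNReal.ofReal_sum_of_nonneg fun e _ => mul_nonneg (ha X e) (le_max_right _ _)]
        refine Finset.sum_le_sum fun e _ => ?_
        rw [ENNReal.ofReal_mul (ha X e)]
        by_cases h0 : a X e = 0
        · simp [h0]
        refine mul_le_mul_right (le_tsum_mul_of_forall_support _ _ _ fun Y hY => ?_) _
        have := hs X e h0 Y hY
        rw [ENNReal.ofReal_max, ENNReal.ofReal_zero, max_eq_left zero_le]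
        exact ENNReal.ofReal_le_ofReal (by linarith)

end EventDrift

/-! ### Bookkeeping of server moves -/

section Moves

variable {I : Type*} [Fintype I] [DecidableEq I] {K : Finset (I → ℕ)}

theorem mem_serverConfigs {c : ServerConfig I} :
    c ∈ serverConfigs K ↔ (c.1 ∈ K ∧ c.2 ∈ K) ∧ ∀ i, c.2 i ≤ c.1 i := by
  simp [serverConfigs]

theorem mem_completeConfigs {c : ServerConfig I} :
    c ∈ completeConfigs K ↔ c ∈ serverConfigs K ∧ c.1 ≠ 0 := by
  simp [completeConfigs]

theorem mk_mem_serverConfigs (hmono : ∀ k ∈ K, ∀ k' : I → ℕ, k' ≤ k → k' ∈ K)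
    {c : ServerConfig I} (h1 : c.1 ∈ K) (h2 : ∀ i, c.2 i ≤ c.1 i) : c ∈ serverConfigs K :=
  mem_serverConfigs.2 ⟨⟨h1, hmono _ h1 _ h2⟩, h2⟩

theorem count_coe (X : State K) (c : completeConfigs K) : count X c.1 = X c := by
  simp [count]

/-- Positivity of the count keeps the natural subtraction in `move` from truncating. `φ` has to
vanish off `completeConfigs` because the state does not record such servers. -/
theorem sum_move (X : State K) {c c' : ServerConfig I} (φ : ServerConfig I → ℕ)
    (hc : c ∈ completeConfigs K → 0 < count X c) (hφ : c ∉ completeConfigs K → φ c = 0)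
    (hφ' : c' ∉ completeConfigs K → φ c' = 0) :
    ∑ d : completeConfigs K, φ d.1 * move X c c' d + φ c
      = ∑ d : completeConfigs K, φ d.1 * X d + φ c' := by
  have hind : ∀ e : ServerConfig I, (e ∉ completeConfigs K → φ e = 0) →
      φ e = ∑ d : completeConfigs K, φ d.1 * (if d.1 = e then 1 else 0) := by
    intro e he
    by_cases hmem : e ∈ completeConfigs K
    · rw [Finset.sum_eq_single ⟨e, hmem⟩]
      · simp
      · intro d _ hd
        rw [if_neg fun h => hd (Subtype.ext h), mul_zero]
      · simp
    · rw [he hmem, Finset.sum_eq_zero]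
      intro d _
      rw [if_neg fun h : d.1 = e => hmem (h ▸ d.2), mul_zero]
  rw [hind c hφ, hind c' hφ', ← Finset.sum_add_distrib, ← Finset.sum_add_distrib]
  refine Finset.sum_congr rfl fun d _ => ?_
  rw [← mul_add, ← mul_add]
  congr 1
  have hd : d.1 = c → 1 ≤ X d := by
    intro h
    have := hc (by rw [← h]; exact d.2)
    rwa [← h, count_coe] at this
  simp only [move]
  by_cases h1 : d.1 = c
  · have := hd h1
    simp only [if_pos h1]
    omega
  · simp only [if_neg h1]
    omega

/-- `c` is a server configuration which is idle or present in the state. -/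
def Present (X : State K) (c : ServerConfig I) : Prop :=
  c ∈ serverConfigs K ∧ (c.1 = 0 ∨ 0 < count X c)

theorem Present.count_pos {X : State K} {c : ServerConfig I} (h : Present X c) :
    c ∈ completeConfigs K → 0 < count X c := fun hc =>
  h.2.resolve_left (mem_completeConfigs.1 hc).2

theorem fst_eq_zero_of_notMem {c : ServerConfig I} (h : c ∈ serverConfigs K)
    (hc : c ∉ completeConfigs K) : c.1 = 0 := by
  by_contra h0
  exact hc (mem_completeConfigs.2 ⟨h, h0⟩)

theorem snd_eq_zero {c : ServerConfig I} (h : c ∈ serverConfigs K) (h0 : c.1 = 0) (i : I) :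
    c.2 i = 0 := by
  have := (mem_serverConfigs.1 h).2 i
  rw [h0] at this
  exact Nat.le_zero.1 this

theorem numServers_move {X : State K} {c c' : ServerConfig I} (hc : Present X c)
    (hc' : c' ∈ serverConfigs K) {k : I → ℕ} (hk : k ≠ 0) :
    numServers (move X c c') k + (if c.1 = k then 1 else 0)
      = numServers X k + (if c'.1 = k then 1 else 0) := by
  have := sum_move X (c := c) (c' := c') (fun d => if d.1 = k then 1 else 0) hc.count_pos
    (fun h => by rw [if_neg]; rw [fst_eq_zero_of_notMem hc.1 h]; exact hk.symm)
    (fun h => by rw [if_neg]; rw [fst_eq_zero_of_notMem hc' h]; exact hk.symm)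
  simpa [numServers] using this

theorem numServers_zero (X : State K) : numServers X 0 = 0 := by
  unfold numServers
  refine Finset.sum_eq_zero fun c _ => ?_
  rw [if_neg (mem_completeConfigs.1 c.2).2]

theorem numActual_move {X : State K} {c c' : ServerConfig I} (hc : Present X c)
    (hc' : c' ∈ serverConfigs K) (i : I) :
    numActual (move X c c') i + c.2 i = numActual X i + c'.2 i :=
  sum_move X (fun d => d.2 i) hc.count_pos
    (fun h => snd_eq_zero hc.1 (fst_eq_zero_of_notMem hc.1 h) i)
    (fun h => snd_eq_zero hc' (fst_eq_zero_of_notMem hc' h) i)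

theorem numTokens_move {X : State K} {c c' : ServerConfig I} (hc : Present X c)
    (hc' : c' ∈ serverConfigs K) (i : I) :
    numTokens (move X c c') i + (c.1 i - c.2 i) = numTokens X i + (c'.1 i - c'.2 i) :=
  sum_move X (fun d => d.1 i - d.2 i) hc.count_pos
    (fun h => by simp [fst_eq_zero_of_notMem hc.1 h])
    (fun h => by simp [fst_eq_zero_of_notMem hc' h])

theorem exists_of_numServers_pos {X : State K} {k : I → ℕ} (h : 0 < numServers X k) :
    ∃ c ∈ serverConfigs K, c.1 = k ∧ 0 < count X c := by
  obtain ⟨c, -, hc⟩ := Finset.exists_ne_zero_of_sum_ne_zero h.ne'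
  rw [ne_eq, ite_eq_right_iff, Classical.not_imp] at hc
  exact ⟨c.1, (mem_completeConfigs.1 c.2).1, hc.1, by rw [count_coe]; omega⟩

theorem count_move_pos (X : State K) (c : ServerConfig I) {c' : ServerConfig I}
    (h : c' ∈ completeConfigs K) : 0 < count (move X c c') c' := by
  simp [count, h, move]

/-- Each server contains at least `k_i - (number of tokens)` customers of type `i`. -/
theorem numServers_le_sum_add_numTokens (X : State K) {k : I → ℕ} {i : I} (hk : 0 < k i) :
    numServers X k ≤
      ∑ c : completeConfigs K, (if c.1.1 = k then c.1.2 i * X c else 0) + numTokens X i := by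
  unfold numServers numTokens
  rw [← Finset.sum_add_distrib]
  refine Finset.sum_le_sum fun c _ => ?_
  by_cases h : c.1.1 = k
  · simp only [h, if_true]
    rw [← add_mul]
    refine Nat.le_mul_of_pos_left _ ?_
    omega
  · simp [h]

end Moves

/-! ### Weights and the change of threshold -/

section Weights

/-- The weight `1 ∧ (n / T)` with a fixed threshold `T`. -/
def fixedWeight (T : ℝ) (n : ℕ) : ℝ := min 1 ((n : ℝ) / T)

@[simp] theorem fixedWeight_zero (T : ℝ) : fixedWeight T 0 = 0 := by simp [fixedWeight]

theorem fixedWeight_nonneg {T : ℝ} (hT : 0 ≤ T) (n : ℕ) : 0 ≤ fixedWeight T n :=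
  le_min zero_le_one (by positivity)

theorem fixedWeight_le_one (T : ℝ) (n : ℕ) : fixedWeight T n ≤ 1 := min_le_left _ _

theorem fixedWeight_mono {T : ℝ} (hT : 0 ≤ T) : Monotone (fixedWeight T) := fun m n h => by
  unfold fixedWeight; gcongr

theorem fixedWeight_le_add {T : ℝ} (hT : 0 < T) {m n a : ℕ} (h : m ≤ n + a) :
    fixedWeight T m ≤ fixedWeight T n + a / T := by
  have h1 : (m : ℝ) / T ≤ n / T + a / T := by
    rw [← add_div]; gcongr; exact_mod_cast h
  have h2 : 0 ≤ (a : ℝ) / T := by positivity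
  unfold fixedWeight
  rcases min_choice 1 ((n : ℝ) / T) with h3 | h3 <;> rw [h3]
  · exact (min_le_left _ _).trans (by linarith)
  · exact (min_le_right _ _).trans h1

/-- For exponents between 0 and 1, `s ^ p` lies between 1 and `s`. -/
theorem abs_rpow_sub_one_le {s p : ℝ} (hs : 0 < s) (hp : 0 ≤ p) (hp1 : p ≤ 1) :
    |s ^ p - 1| ≤ |s - 1| := by
  rcases le_total 1 s with h | h
  · have h1 := Real.one_le_rpow h hp
    have h2 := Real.rpow_le_rpow_of_exponent_le h hp1
    rw [Real.rpow_one] at h2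
    rw [abs_of_nonneg (by linarith), abs_of_nonneg (by linarith)]
    linarith
  · have h1 := Real.rpow_le_one hs.le h hp
    have h2 := Real.rpow_le_rpow_of_exponent_ge hs h hp1
    rw [Real.rpow_one] at h2
    rw [abs_of_nonpos (by linarith), abs_of_nonpos (by linarith)]
    linarith

/-- Capping at 1 turns a relative error `τ` of the argument into an absolute error that does not
depend on `m`. -/
theorem abs_min_one_sub_le {m τ : ℝ} (hm : 0 ≤ m) (hτ : 0 ≤ τ) :
    |min 1 m - min 1 (m * τ)| ≤ |τ - 1| := by
  rcases le_total 1 τ with h | h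
  · rw [abs_of_nonneg (show 0 ≤ τ - 1 by linarith), abs_le]
    rcases le_total 1 m with h1 | h1
    · rw [min_eq_left h1, min_eq_left (by nlinarith)]
      constructor <;> linarith
    · rw [min_eq_right h1]
      refine ⟨?_, ?_⟩
      · have := min_le_right 1 (m * τ); nlinarith
      · have : m ≤ min 1 (m * τ) := le_min h1 (by nlinarith)
        linarith
  · rw [abs_of_nonpos (show τ - 1 ≤ 0 by linarith), abs_le]
    rcases le_total 1 m with h1 | h1
    · rw [min_eq_left h1]
      refine ⟨by linarith [min_le_left 1 (m * τ)], ?_⟩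
      have : τ ≤ min 1 (m * τ) := le_min h (by nlinarith)
      linarith
    · rw [min_eq_right h1, min_eq_right (by nlinarith)]
      constructor <;> nlinarith

/-- The effect of replacing the threshold `Z ^ p` by `r ^ p`. -/
theorem abs_weight_sub_fixedWeight_le {p r : ℝ} (hp : 0 < p) (hp1 : p ≤ 1) (hr : 0 < r)
    (Z n : ℕ) : |weight p Z n - fixedWeight (r ^ p) n| ≤ |(Z : ℝ) - r| / r := by
  have hT : 0 < r ^ p := Real.rpow_pos_of_pos hr p
  -- For `Z = 0` the weights vanish by convention, and the claimed bound equals 1.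
  rcases Nat.eq_zero_or_pos Z with rfl | hZ
  · have h1 := fixedWeight_nonneg hT.le n
    have h2 := fixedWeight_le_one (r ^ p) n
    have h3 : weight p 0 n = 0 := by simp [weight, Real.zero_rpow hp.ne']
    rw [h3, Nat.cast_zero, zero_sub, zero_sub, abs_neg, abs_neg, abs_of_pos hr, div_self hr.ne',
      abs_of_nonneg h1]
    exact h2
  · have hZ' : (0 : ℝ) < Z := by exact_mod_cast hZ
    have ha : 0 < (Z : ℝ) ^ p := Real.rpow_pos_of_pos hZ' p
    have h1 : (n : ℝ) / r ^ p = n / (Z : ℝ) ^ p * (Z / r) ^ p := by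
      rw [Real.div_rpow hZ'.le hr.le]; field_simp
    unfold weight fixedWeight
    rw [h1]
    refine (abs_min_one_sub_le (by positivity) (by positivity)).trans ?_
    refine (abs_rpow_sub_one_le (by positivity) hp.le hp1).trans (le_of_eq ?_)
    rw [div_sub_one hr.ne', abs_div, abs_of_pos hr]

end Weights

/-! ### The potential and greedy placements -/

section Potential

variable {I : Type*} [Fintype I] [DecidableEq I] {K : Finset (I → ℕ)}

/-- The potential `∑_k ∑_{m < X_k} w(m)` with the fixed threshold `T`, which the placement rule
decreases greedily. -/
def potential (T : ℝ) (X : State K) : ℝ :=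
  ∑ k ∈ nonzeroConfigs K, ∑ m ∈ Finset.range (numServers X k), fixedWeight T m

theorem potential_nonneg {T : ℝ} (hT : 0 ≤ T) (X : State K) : 0 ≤ potential T X :=
  Finset.sum_nonneg fun _ _ => Finset.sum_nonneg fun _ _ => fixedWeight_nonneg hT _

theorem potential_congr (T : ℝ) {X Y : State K} (h : ∀ k, k ≠ 0 → numServers Y k = numServers X k) :
    potential T Y = potential T X :=
  Finset.sum_congr rfl fun k hk => by rw [h k (Finset.mem_filter.1 hk).2]

/-- Only the top terms of two inner sums change: one is added at `X_{c'}`, one is removed at `X_c -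
1`. An idle server contributes `fixedWeight T 0 = 0` in either role. -/
theorem potential_move (T : ℝ) {X : State K} {c c' : ServerConfig I} (hc : Present X c)
    (hc' : c' ∈ serverConfigs K) (hne : c.1 ≠ c'.1) :
    potential T (move X c c') = potential T X + fixedWeight T (numServers X c'.1)
      - fixedWeight T (numServers X c.1 - 1) := by
  have hterm : ∀ k ∈ nonzeroConfigs K,
      ∑ m ∈ Finset.range (numServers (move X c c') k), fixedWeight T m
        = ∑ m ∈ Finset.range (numServers X k), fixedWeight T m
          + (if c'.1 = k then fixedWeight T (numServers X k) else 0)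
          - (if c.1 = k then fixedWeight T (numServers X k - 1) else 0) := by
    intro k hk
    have hmove := numServers_move hc hc' (Finset.mem_filter.1 hk).2
    by_cases h1 : c.1 = k
    · have h2 : c'.1 ≠ k := fun h => hne (h1.trans h.symm)
      rw [if_pos h1, if_neg h2] at hmove
      rw [if_neg h2, if_pos h1, ← show numServers (move X c c') k = numServers X k - 1 by omega,
        show numServers X k = numServers (move X c c') k + 1 by omega, Finset.sum_range_succ]
      ring
    · by_cases h2 : c'.1 = k
      · rw [if_neg h1, if_pos h2] at hmove
        rw [if_pos h2, if_neg h1, show numServers (move X c c') k = numServers X k + 1 by omega,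
          Finset.sum_range_succ]
        ring
      · rw [if_neg h1, if_neg h2] at hmove
        rw [if_neg h2, if_neg h1, show numServers (move X c c') k = numServers X k by omega]
        ring
  have hmem : ∀ d : ServerConfig I, d ∈ serverConfigs K → ∀ F : ℕ → ℝ, F 0 = 0 →
      ∑ k ∈ nonzeroConfigs K, (if d.1 = k then F (numServers X k) else 0)
        = F (numServers X d.1) := by
    intro d hd F hF
    rw [Finset.sum_ite_eq]
    split_ifs with h
    · rfl
    · have : d.1 = 0 := by
        by_contra h0
        exact h (Finset.mem_filter.2 ⟨(mem_serverConfigs.1 hd).1.1, h0⟩)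
      rw [this, numServers_zero, hF]
  unfold potential
  rw [Finset.sum_congr rfl hterm, Finset.sum_sub_distrib, Finset.sum_add_distrib,
    hmem c' hc' (fun n => fixedWeight T n) (by simp),
    hmem c hc.1 (fun n => fixedWeight T (n - 1)) (by simp)]

theorem potential_move_le_add_one {T : ℝ} (hT : 0 ≤ T) {X : State K} {c c' : ServerConfig I}
    (hc : Present X c) (hc' : c' ∈ serverConfigs K) (hne : c.1 ≠ c'.1) :
    potential T (move X c c') ≤ potential T X + 1 := by
  rw [potential_move T hc hc' hne]
  have := fixedWeight_le_one T (numServers X c'.1)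
  have := fixedWeight_nonneg hT (numServers X c.1 - 1)
  linarith

theorem add_single_ne (k : I → ℕ) (i : I) : k ≠ k + Pi.single i 1 := fun h => by
  have := congrFun h i
  simp at this

theorem sub_single_ne {k : I → ℕ} {i : I} (h : 0 < k i) : k ≠ k - Pi.single i 1 := fun h' => by
  have := congrFun h' i
  simp at this
  omega

theorem CanPlace.present {X : State K} {i : I} {c : ServerConfig I} (h : CanPlace X i c) :
    Present X c := ⟨h.1, h.2.2⟩

/-- A GSS placement increases the potential by hardly more than any other possible placement. -/
theorem potential_placement_le {p r : ℝ} (hp : 0 < p) (hp1 : p ≤ 1) (hr : 0 < r) {X : State K}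
    {i : I} {c c' : ServerConfig I} (hgss : IsGSSPlacement p X i c)
    (hc' : c' ∈ serverConfigs K) (hc'1 : c'.1 = c.1 + Pi.single i 1)
    {j : ServerConfig I} (hj : CanPlace X i j) :
    potential (r ^ p) (move X c c') ≤ potential (r ^ p) X
      + (fixedWeight (r ^ p) (numServers X (j.1 + Pi.single i 1))
        - fixedWeight (r ^ p) (numServers X j.1))
      + (1 / r ^ p + 4 * (|(totalActual X : ℝ) - r| / r)) := by
  have hT : 0 < r ^ p := Real.rpow_pos_of_pos hr p
  rw [potential_move _ hgss.1.present hc' (by rw [hc'1]; exact add_single_ne _ _), hc'1]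
  have h1 := hgss.2 j hj
  unfold weightDiff at h1
  have e := fun n => abs_le.1 (abs_weight_sub_fixedWeight_le hp hp1 hr (totalActual X) n)
  have e1 := e (numServers X (c.1 + Pi.single i 1))
  have e2 := e (numServers X c.1)
  have e3 := e (numServers X (j.1 + Pi.single i 1))
  have e4 := e (numServers X j.1)
  have h2 := fixedWeight_le_add hT (show numServers X c.1 ≤ numServers X c.1 - 1 + 1 by omega)
  push_cast at h2
  linarith [e1.1, e1.2, e2.1, e2.2, e3.1, e3.2, e4.1, e4.2]

/-- The weight of a configuration, from which one server is discounted. -/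
def shiftedWeight (T : ℝ) (X : State K) (k : I → ℕ) : ℝ := fixedWeight T (numServers X k - 1)

/-- A customer can be added to a configuration even after one server has left it. -/
def Available (X : State K) (i : I) (j : I → ℕ) : Prop :=
  j + Pi.single i 1 ∈ K ∧ (j = 0 ∨ 2 ≤ numServers X j)

theorem totalActual_eq_of_numActual {X Y : State K} {i : I} {α : ℝ}
    (h : ∀ j, (numActual Y j : ℝ) = numActual X j + if j = i then α else 0) :
    (totalActual Y : ℝ) = totalActual X + α := by
  simp [totalActual, h, Finset.sum_add_distrib]

/-- The state right after the removal of a customer of type `i` from a server of configuration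
`c`. -/
def afterRemoval (X : State K) (c : ServerConfig I) (i : I) : State K :=
  move X c (c.1 - Pi.single i 1, c.2 - Pi.single i 1)

section Removal

variable {X : State K} {c : completeConfigs K} {i : I}

theorem present_coe (hX : 0 < X c) : Present X c.1 :=
  ⟨(mem_completeConfigs.1 c.2).1, Or.inr (by rwa [count_coe])⟩

theorem removal_mem (hmono : ∀ k ∈ K, ∀ k' : I → ℕ, k' ≤ k → k' ∈ K)
    : ((c.1.1 - Pi.single i 1, c.1.2 - Pi.single i 1) : ServerConfig I)
    ∈ serverConfigs K := by
  have hc := mem_serverConfigs.1 (mem_completeConfigs.1 c.2).1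
  refine mk_mem_serverConfigs hmono (hmono _ hc.1.1 _ fun j => by simp) fun j => ?_
  have := hc.2 j
  simp only [Pi.sub_apply]
  omega

theorem numServers_afterRemoval (hmono : ∀ k ∈ K, ∀ k' : I → ℕ, k' ≤ k → k' ∈ K)
    (hX : 0 < X c) {k : I → ℕ} (hk : k ≠ 0) :
    numServers (afterRemoval X c.1 i) k + (if c.1.1 = k then 1 else 0)
      = numServers X k + (if c.1.1 - Pi.single i 1 = k then 1 else 0) :=
  numServers_move (present_coe hX) (removal_mem hmono) hk

theorem numActual_afterRemoval (hmono : ∀ k ∈ K, ∀ k' : I → ℕ, k' ≤ k → k' ∈ K)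
    (hX : 0 < X c) (hi : 0 < c.1.2 i) (j : I) :
    (numActual (afterRemoval X c.1 i) j : ℝ) = numActual X j + if j = i then -1 else 0 := by
  have h := numActual_move (present_coe hX) (removal_mem hmono (c := c) (i := i)) j
  by_cases hj : j = i
  · subst hj
    simp only [Pi.sub_apply, Pi.single_eq_same] at h
    have : numActual (move X c.1 (c.1.1 - Pi.single j 1, c.1.2 - Pi.single j 1)) j + 1
        = numActual X j := by omega
    simp only [if_true, afterRemoval]
    rw [← this]
    push_cast
    ring
  · simp only [Pi.sub_apply, Pi.single_eq_of_ne hj] at h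
    simp only [if_neg hj, afterRemoval, add_zero]
    exact_mod_cast (by omega : numActual
      (move X c.1 (c.1.1 - Pi.single i 1, c.1.2 - Pi.single i 1)) j = numActual X j)

theorem numTokens_afterRemoval (hmono : ∀ k ∈ K, ∀ k' : I → ℕ, k' ≤ k → k' ∈ K)
    (hX : 0 < X c) (hi : 0 < c.1.2 i) (j : I) :
    numTokens (afterRemoval X c.1 i) j = numTokens X j := by
  have h := numTokens_move (present_coe hX) (removal_mem hmono (c := c) (i := i)) j
  have hle := (mem_serverConfigs.1 (mem_completeConfigs.1 c.2).1).2 j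
  unfold afterRemoval
  by_cases hj : j = i
  · subst hj
    simp only [Pi.sub_apply, Pi.single_eq_same] at h
    omega
  · simp only [Pi.sub_apply, Pi.single_eq_of_ne hj] at h
    omega

/-- The increment of the potential caused by a service completion, compared with an arbitrary
placement of the new token. -/
theorem potential_service_le (hmono : ∀ k ∈ K, ∀ k' : I → ℕ, k' ≤ k → k' ∈ K)
    {p r : ℝ} (hp : 0 < p) (hp1 : p ≤ 1) (hr : 0 < r)
    (hX : 0 < X c) (hi : 0 < c.1.2 i) {d d' : ServerConfig I}
    (hgss : IsGSSPlacement p (afterRemoval X c.1 i) i d) (hd' : d' ∈ serverConfigs K)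
    (hd'1 : d'.1 = d.1 + Pi.single i 1) {j : I → ℕ}
    (hj : Available X i j ∨ j = c.1.1 - Pi.single i 1) :
    potential (r ^ p) (move (afterRemoval X c.1 i) d d') ≤ potential (r ^ p) X
      + (shiftedWeight (r ^ p) X (j + Pi.single i 1) - shiftedWeight (r ^ p) X j)
      - (shiftedWeight (r ^ p) X c.1.1 - shiftedWeight (r ^ p) X (c.1.1 - Pi.single i 1))
      + (4 / r ^ p + 4 * ((|(totalActual X : ℝ) - r| + 1) / r)) := by
  have hT : 0 < r ^ p := Real.rpow_pos_of_pos hr p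
  have hc := mem_serverConfigs.1 (mem_completeConfigs.1 c.2).1
  have hi1 : 0 < c.1.1 i := hi.trans_le (hc.2 i)
  have hnum : ∀ k : I → ℕ, numServers (afterRemoval X c.1 i) k ≤ numServers X k + 1 ∧
      numServers X k - 1 ≤ numServers (afterRemoval X c.1 i) k := by
    intro k
    by_cases hk : k = 0
    · simp [hk, numServers_zero]
    have := numServers_afterRemoval hmono hX hk (i := i)
    split_ifs at this <;> omega
  -- An available `j` has two servers, or is idle, so it survives the departure from `c`. The other
  -- choice returns the token to the server just vacated.
  have hplace : ∃ e : ServerConfig I, e.1 = j ∧ CanPlace (afterRemoval X c.1 i) i e := by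
    rcases hj with ⟨hjK, hj0 | hj2⟩ | hj
    · have h0 : (0 : I → ℕ) ∈ K := hmono _ hc.1.1 _ fun _ => Nat.zero_le _
      refine ⟨(0, 0), hj0.symm, mk_mem_serverConfigs hmono h0 fun _ => le_rfl, ?_, Or.inl rfl⟩
      rw [← hj0]; exact hjK
    · obtain ⟨e, he, hej, hcount⟩ := exists_of_numServers_pos
        (show 0 < numServers (afterRemoval X c.1 i) j by have := (hnum j).2; omega)
      exact ⟨e, hej, he, by rwa [hej], Or.inr hcount⟩
    · refine ⟨(c.1.1 - Pi.single i 1, c.1.2 - Pi.single i 1), hj.symm, removal_mem hmono, ?_, ?_⟩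
      · simp only [sub_single_add_single hi1]
        exact hc.1.1
      · by_cases h0 : c.1.1 - Pi.single i 1 = 0
        · exact Or.inl h0
        · exact Or.inr (count_move_pos _ _ (mem_completeConfigs.2 ⟨removal_mem hmono, h0⟩))
  obtain ⟨e, hej, hplace⟩ := hplace
  have h1 := potential_placement_le hp hp1 hr hgss hd' hd'1 hplace
  rw [hej] at h1
  have h2 : potential (r ^ p) (afterRemoval X c.1 i) = _ :=
    potential_move (r ^ p) (present_coe hX) (removal_mem hmono (c := c) (i := i)) (sub_single_ne hi1)
  -- The four units of `1 / r ^ p`: one from the placement bound, one here for the discounted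
  -- server, and two in `h4`, since the removal may add a server and the shifted weight discounts
  -- another.
  have h3 := fixedWeight_le_add hT (m := numServers X (c.1.1 - Pi.single i 1))
    (n := numServers X (c.1.1 - Pi.single i 1) - 1) (a := 1) (by omega)
  have h4 := fixedWeight_le_add hT (m := numServers (afterRemoval X c.1 i) (j + Pi.single i 1))
    (n := numServers X (j + Pi.single i 1) - 1) (a := 2)
    (by have := (hnum (j + Pi.single i 1)).1; omega)
  have h5 := fixedWeight_mono hT.le (hnum j).2
  have hZ := totalActual_eq_of_numActual (numActual_afterRemoval hmono hX hi)
  have h6 : |(totalActual (afterRemoval X c.1 i) : ℝ) - r| / r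
      ≤ (|(totalActual X : ℝ) - r| + 1) / r := by
    gcongr
    rw [hZ]
    calc |(totalActual X : ℝ) + -1 - r| = |((totalActual X : ℝ) - r) + -1| := by ring_nf
      _ ≤ _ := (abs_add_le _ _).trans (by simp)
  push_cast at h3 h4
  unfold shiftedWeight
  simp only at h2
  have h7 : 4 / r ^ p = 1 / r ^ p + 1 / r ^ p + 2 / r ^ p := by ring
  linarith

end Removal

end Potential

/-! ### The Lyapunov function and its increments -/

section Lyapunov

variable {I : Type*} [Fintype I] [DecidableEq I] {K : Finset (I → ℕ)}

/-- The Lyapunov function: the potential, minus the number of customers and tokens, plus a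
quadratic penalty for deviations of the customer counts from `m` and for tokens. -/
def lyapunov (T h a : ℝ) (m : I → ℝ) (X : State K) : ℝ :=
  potential T X - ∑ i, ((numActual X i : ℝ) + numTokens X i)
    + h * ∑ i, (a * ((numActual X i : ℝ) - m i) ^ 2 + (numTokens X i : ℝ) ^ 2)

theorem lyapunov_le_of_update {T h a : ℝ} {m : I → ℝ} {X Y : State K} {i : I} {α τ σ : ℝ}
    (hα : ∀ j, (numActual Y j : ℝ) = numActual X j + if j = i then α else 0)
    (hτ : ∀ j, (numTokens Y j : ℝ) = numTokens X j + if j = i then τ else 0)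
    (hσ : potential T Y ≤ potential T X + σ) :
    lyapunov T h a m Y ≤ lyapunov T h a m X + (σ - (α + τ)
      + h * (a * (2 * α * (numActual X i - m i) + α ^ 2) + (2 * τ * numTokens X i + τ ^ 2))) := by
  have h1 : ∑ j, ((numActual Y j : ℝ) + numTokens Y j)
      = ∑ j, ((numActual X j : ℝ) + numTokens X j) + (α + τ) := by
    simp only [hα, hτ, Finset.sum_add_distrib, Finset.sum_ite_eq', Finset.mem_univ, if_true]
    ring
  have h2 : ∑ j, (a * ((numActual Y j : ℝ) - m j) ^ 2 + (numTokens Y j : ℝ) ^ 2)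
      = ∑ j, (a * ((numActual X j : ℝ) - m j) ^ 2 + (numTokens X j : ℝ) ^ 2)
        + (a * (2 * α * (numActual X i - m i) + α ^ 2) + (2 * τ * numTokens X i + τ ^ 2)) := by
    have : ∀ j, a * ((numActual Y j : ℝ) - m j) ^ 2 + (numTokens Y j : ℝ) ^ 2
        = a * ((numActual X j : ℝ) - m j) ^ 2 + (numTokens X j : ℝ) ^ 2 + if j = i then
          a * (2 * α * (numActual X i - m i) + α ^ 2) + (2 * τ * numTokens X i + τ ^ 2) else 0 := by
      intro j
      rw [hα, hτ]
      split_ifs with hj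
      · subst hj; ring
      · ring
    rw [Finset.sum_congr rfl fun j _ => this j, Finset.sum_add_distrib]
    simp
  unfold lyapunov
  rw [h1, h2]
  linarith

theorem le_numActual_add_numTokens (X : State K) (c : completeConfigs K) :
    X c ≤ ∑ i, (numActual X i + numTokens X i) := by
  have hc := mem_completeConfigs.1 c.2
  obtain ⟨i, hi⟩ := Function.ne_iff.1 hc.2
  have hle := (mem_serverConfigs.1 hc.1).2 i
  have h1 : c.1.2 i * X c ≤ numActual X i :=
    Finset.single_le_sum (f := fun c : completeConfigs K => c.1.2 i * X c)
      (fun _ _ => Nat.zero_le _) (Finset.mem_univ c)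
  have h2 : (c.1.1 i - c.1.2 i) * X c ≤ numTokens X i :=
    Finset.single_le_sum (f := fun c : completeConfigs K => (c.1.1 i - c.1.2 i) * X c)
      (fun _ _ => Nat.zero_le _) (Finset.mem_univ c)
  have h3 : X c ≤ c.1.2 i * X c + (c.1.1 i - c.1.2 i) * X c := by
    rw [← add_mul]
    refine Nat.le_mul_of_pos_left _ ?_
    simp only [Pi.zero_apply] at hi
    omega
  have h4 : numActual X i + numTokens X i ≤ ∑ i, (numActual X i + numTokens X i) :=
    Finset.single_le_sum (f := fun i => numActual X i + numTokens X i)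
      (fun _ _ => Nat.zero_le _) (Finset.mem_univ i)
  omega

/-- The sublevel sets of the Lyapunov function are finite. -/
theorem finite_lyapunov_lt {T h a : ℝ} (hT : 0 ≤ T) (hh : 0 < h) (ha : 1 ≤ a) (m : I → ℝ)
    (N : ℝ) : {X : State K | lyapunov T h a m X < N}.Finite := by
  set M : ℝ := N + ∑ i, (2 * m i + 2 * h⁻¹) with hM
  refine (Set.finite_Iic fun _ : completeConfigs K => ⌈M⌉₊).subset ?_
  intro X hX c
  have hX : lyapunov T h a m X < N := hX
  -- The quadratic penalty dominates twice the linear term, so subtracting the number of customers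
  -- and tokens preserves coercivity.
  have hsq : ∀ x : ℝ, 2 * x - h⁻¹ ≤ h * x ^ 2 := by
    intro x
    have : 0 ≤ h * (x - h⁻¹) ^ 2 := by positivity
    have e : h * (x - h⁻¹) ^ 2 = h * x ^ 2 - 2 * x + h⁻¹ := by field_simp; ring
    linarith
  have hterm : ∀ i, (numActual X i : ℝ) + numTokens X i - (2 * m i + 2 * h⁻¹)
      ≤ h * (a * ((numActual X i : ℝ) - m i) ^ 2 + (numTokens X i : ℝ) ^ 2)
        - ((numActual X i : ℝ) + numTokens X i) := by
    intro i
    have h1 := hsq ((numActual X i : ℝ) - m i)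
    have h2 := hsq (numTokens X i : ℝ)
    have h3 : h * ((numActual X i : ℝ) - m i) ^ 2 ≤ h * (a * ((numActual X i : ℝ) - m i) ^ 2) := by
      gcongr
      exact le_mul_of_one_le_left (sq_nonneg _) ha
    rw [mul_add]
    linarith
  have hsum := Finset.sum_le_sum fun i (_ : i ∈ Finset.univ) => hterm i
  rw [Finset.sum_sub_distrib, Finset.sum_sub_distrib, ← Finset.mul_sum] at hsum
  have hpot := potential_nonneg hT X
  unfold lyapunov at hX
  have hle : ((∑ i, (numActual X i + numTokens X i) : ℕ) : ℝ) ≤ M := by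
    push_cast
    linarith
  have := Nat.le_ceil M
  exact (le_numActual_add_numTokens X c).trans (by exact_mod_cast hle.trans this)

theorem numActual_move_cast {X : State K} {c c' : ServerConfig I} (hc : Present X c)
    (hc' : c' ∈ serverConfigs K) (i : I) :
    (numActual (move X c c') i : ℝ) = numActual X i + ((c'.2 i : ℝ) - c.2 i) := by
  have : (numActual (move X c c') i : ℝ) + c.2 i = numActual X i + c'.2 i := by
    exact_mod_cast numActual_move hc hc' i
  linarith

theorem numTokens_move_cast {X : State K} {c c' : ServerConfig I} (hc : Present X c)
    (hc' : c' ∈ serverConfigs K) (i : I) :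
    (numTokens (move X c c') i : ℝ)
      = numTokens X i + (((c'.1 i : ℝ) - c'.2 i) - ((c.1 i : ℝ) - c.2 i)) := by
  have h := numTokens_move hc hc' i
  have h1 := (mem_serverConfigs.1 hc.1).2 i
  have h2 := (mem_serverConfigs.1 hc').2 i
  have : numTokens (move X c c') i + c.1 i + c'.2 i = numTokens X i + c'.1 i + c.2 i := by omega
  have : (numTokens (move X c c') i : ℝ) + c.1 i + c'.2 i = numTokens X i + c'.1 i + c.2 i := by
    exact_mod_cast this
  linarith

theorem HoldsToken.present {X : State K} {i : I} {c : ServerConfig I} (h : HoldsToken X i c) :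
    Present X c := by
  have : c ∈ completeConfigs K := by
    by_contra hc
    have := h.1
    simp [count, hc] at this
  exact ⟨(mem_completeConfigs.1 this).1, Or.inr h.1⟩


/-- Replacing a token changes neither the potential nor the total. A new placement raises the
potential by at most 1, which the increase of the total pays for. -/
theorem lyapunov_afterArrival_le (hmono : ∀ k ∈ K, ∀ k' : I → ℕ, k' ≤ k → k' ∈ K)
    {p T h a : ℝ} (hT : 0 ≤ T) (hh : 0 ≤ h) (m : I → ℝ) (P : GSSMPolicy K p) (X : State K) (i : I)
    (Y : State K) (hY : Y ∈ (P.afterArrival X i).support) :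
    lyapunov T h a m Y ≤ lyapunov T h a m X
      + h * (a * (2 * (numActual X i - m i) + 1) + (1 - 2 * numTokens X i)) := by
  unfold GSSMPolicy.afterArrival at hY
  split_ifs at hY with ht
  · obtain ⟨c, hc, rfl⟩ := (PMF.mem_support_map_iff _ _ _).1 hY
    have htok := P.replaceToken_holds X i ht c hc
    have hK := mem_serverConfigs.1 htok.present.1
    have hc' : ((c.1, c.2 + Pi.single i 1) : ServerConfig I) ∈ serverConfigs K := by
      refine mk_mem_serverConfigs hmono hK.1.1 fun j => ?_
      have := hK.2 j
      by_cases hj : j = i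
      · subst hj; simpa using htok.2
      · simpa [hj] using this
    refine (lyapunov_le_of_update (X := X) (i := i) (α := 1) (τ := -1) (σ := 0) (fun j => ?_) (fun j => ?_)
      ?_).trans (le_of_eq (by ring))
    · rw [numActual_move_cast htok.present hc']
      simp [Pi.single_apply]
    · rw [numTokens_move_cast htok.present hc']
      simp only [Pi.add_apply, Pi.single_apply]
      split_ifs <;> push_cast <;> ring
    · rw [add_zero]
      refine (potential_congr T fun k hk => ?_).le
      have := numServers_move htok.present hc' hk
      simpa using this
  · obtain ⟨c, hc, rfl⟩ := (PMF.mem_support_map_iff _ _ _).1 hY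
    have hgss := P.placeCustomer_gss X i c hc
    have hK := mem_serverConfigs.1 hgss.1.1
    have hc' : ((c.1 + Pi.single i 1, c.2 + Pi.single i 1) : ServerConfig I)
        ∈ serverConfigs K :=
      mk_mem_serverConfigs hmono hgss.1.2.1 fun j => Nat.add_le_add_right (hK.2 j) _
    have ht0 : (numTokens X i : ℝ) = 0 := by
      have : numTokens X i = 0 := by omega
      exact_mod_cast this
    refine (lyapunov_le_of_update (X := X) (i := i) (α := 1) (τ := 0) (σ := 1) (fun j => ?_) (fun j => ?_)
      ?_).trans ?_
    · rw [numActual_move_cast hgss.1.present hc']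
      simp [Pi.single_apply]
    · rw [numTokens_move_cast hgss.1.present hc']
      simp
    · exact potential_move_le_add_one hT hgss.1.present hc' (add_single_ne _ _)
    -- Without tokens the true token increment is 0, and the common formula allows `h ≥ 0`.
    · rw [ht0]
      nlinarith

/-- The 2 consists of a potential increase of at most 1 and the loss of 1 from the total. It is
affordable because expirations occur at a rate proportional to the number of tokens. -/
theorem lyapunov_afterTimeout_le (hmono : ∀ k ∈ K, ∀ k' : I → ℕ, k' ≤ k → k' ∈ K)
    {T h a : ℝ} (hT : 0 ≤ T) (m : I → ℝ) {X : State K} {i : I} {c : completeConfigs K}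
    (hX : 0 < X c) (hi : c.1.2 i < c.1.1 i) :
    lyapunov T h a m (move X c (c.1.1 - Pi.single i 1, c.1.2)) ≤ lyapunov T h a m X
      + (2 + h * (1 - 2 * numTokens X i)) := by
  have hpres := present_coe hX
  have hK := mem_serverConfigs.1 hpres.1
  have hc' : ((c.1.1 - Pi.single i 1, c.1.2) : ServerConfig I) ∈ serverConfigs K := by
    refine mk_mem_serverConfigs hmono (hmono _ hK.1.1 _ fun j => by simp) fun j => ?_
    have := hK.2 j
    by_cases hj : j = i
    · subst hj; simp; omega
    · simpa [hj] using this
  refine (lyapunov_le_of_update (X := X) (i := i) (α := 0) (τ := -1) (σ := 1) (fun j => ?_) (fun j => ?_)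
      ?_).trans (le_of_eq (by ring))
  · rw [numActual_move_cast hpres hc']
    simp
  · rw [numTokens_move_cast hpres hc']
    by_cases hj : j = i
    · subst hj
      have : 1 ≤ c.1.1 j := by omega
      simp [Nat.cast_sub this]
    · simp [hj]
  · exact potential_move_le_add_one hT hpres hc' (sub_single_ne (by omega))

/-- GSS is compared with two reinsertions: into the vacated place, which cancels the removal, and
into `j`. Taking the better one gives `-max 0`, so no service has a positive main term. -/
theorem lyapunov_afterService_le (hmono : ∀ k ∈ K, ∀ k' : I → ℕ, k' ≤ k → k' ∈ K)
    {p r h a : ℝ} (hp : 0 < p) (hp1 : p ≤ 1) (hr : 0 < r) (m : I → ℝ) (P : GSSMPolicy K p)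
    {X : State K} {i : I} {c : completeConfigs K} (hX : 0 < X c) (hi : 0 < c.1.2 i)
    {Y : State K} (hY : Y ∈ (P.afterService X c i).support) {j : I → ℕ} (hj : Available X i j) :
    lyapunov (r ^ p) h a m Y ≤ lyapunov (r ^ p) h a m X
      + (-max 0 (shiftedWeight (r ^ p) X c.1.1 - shiftedWeight (r ^ p) X (c.1.1 - Pi.single i 1)
          - (shiftedWeight (r ^ p) X (j + Pi.single i 1) - shiftedWeight (r ^ p) X j))
        + (4 / r ^ p + 4 * ((|(totalActual X : ℝ) - r| + 1) / r))
        + h * (a * (1 - 2 * (numActual X i - m i)) + (2 * numTokens X i + 1))) := by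
  obtain ⟨d, hd, rfl⟩ := (PMF.mem_support_map_iff _ _ _).1 hY
  have hgss : IsGSSPlacement p (afterRemoval X c.1 i) i d := P.placeToken_gss _ i d hd
  have hK := mem_serverConfigs.1 hgss.1.1
  have hd' : ((d.1 + Pi.single i 1, d.2) : ServerConfig I) ∈ serverConfigs K :=
    mk_mem_serverConfigs hmono hgss.1.2.1 fun j => (hK.2 j).trans (Nat.le_add_right _ _)
  have hi1 : 0 < c.1.1 i := hi.trans_le ((mem_serverConfigs.1 (mem_completeConfigs.1 c.2).1).2 i)
  refine (lyapunov_le_of_update (X := X) (i := i) (α := -1) (τ := 1)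
    (σ := -max 0 (shiftedWeight (r ^ p) X c.1.1 - shiftedWeight (r ^ p) X (c.1.1 - Pi.single i 1)
          - (shiftedWeight (r ^ p) X (j + Pi.single i 1) - shiftedWeight (r ^ p) X j))
        + (4 / r ^ p + 4 * ((|(totalActual X : ℝ) - r| + 1) / r)))
    (Y := move (afterRemoval X c.1 i) d (d.1 + Pi.single i 1, d.2)) (fun k => ?_)
    (fun k => ?_) ?_).trans (le_of_eq (by ring))
  · rw [numActual_move_cast hgss.1.present hd', numActual_afterRemoval hmono hX hi]
    simp
  · rw [numTokens_move_cast hgss.1.present hd', numTokens_afterRemoval hmono hX hi]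
    simp [Pi.single_apply]
  · have h1 := potential_service_le hmono hp hp1 hr hX hi hgss hd' rfl (Or.inl hj)
    have h2 := potential_service_le hmono hp hp1 hr hX hi hgss hd' rfl (Or.inr rfl)
    rw [sub_single_add_single hi1] at h2
    rcases max_choice (0 : ℝ) (shiftedWeight (r ^ p) X c.1.1
      - shiftedWeight (r ^ p) X (c.1.1 - Pi.single i 1)
      - (shiftedWeight (r ^ p) X (j + Pi.single i 1) - shiftedWeight (r ^ p) X j)) with h3 | h3
    · rw [h3]; linarith
    · rw [h3]; linarith

end Lyapunov

/-! ### Arithmetic of the drift -/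

section DriftArithmetic

/-- Here `u` is a customer deviation and `t` a token count. The terms of order `r * u` and `r * t`
cancel between arrivals and services; the remaining cross term `2 * μ * u * t` is absorbed by both
squares once `a` is large compared with `μ / μ0`. -/
theorem quadratic_drift_le {μ μ0 a ρ r u t : ℝ} (hμ : 0 < μ) (hμ0 : 0 < μ0) (ha : 1 ≤ a)
    (haμ : 4 * μ ≤ a * μ0) :
    μ * ρ * r * (a * (2 * u + 1) + (1 - 2 * t))
      + μ * (u + ρ * r) * (a * (1 - 2 * u) + (2 * t + 1)) + μ0 * t * (1 - 2 * t)
    ≤ -(a * μ * u ^ 2) - μ0 * t ^ 2 + ((2 * a + 2) * μ * (ρ * r) + 2 * a * μ + μ0 / 2) := by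
  have h1 : 2 * μ * u * t ≤ μ0 * t ^ 2 / 2 + a * μ * u ^ 2 / 2 := by
    have h2 : μ0 * (2 * μ * u * t) ≤ μ0 * (μ0 * t ^ 2 / 2 + a * μ * u ^ 2 / 2) := by
      have h3 : 0 ≤ (μ0 * t - 2 * μ * u) ^ 2 := sq_nonneg _
      have h4 : 4 * μ * (μ * u ^ 2) ≤ a * μ0 * (μ * u ^ 2) :=
        mul_le_mul_of_nonneg_right haμ (by positivity)
      nlinarith
    exact le_of_mul_le_mul_left h2 hμ0
  have h5 : (a + 1) * μ * u ≤ a * μ * (u ^ 2 / 2 + 2) := by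
    have h6 : (a + 1) * u ≤ a * (u ^ 2 / 2 + 2) := by
      nlinarith [sq_nonneg (u - 2), sq_nonneg (u - 1), sq_nonneg u,
        mul_nonneg (sub_nonneg.2 ha) (sq_nonneg (u - 1)),
        mul_nonneg (sub_nonneg.2 ha) (sq_nonneg u)]
    calc (a + 1) * μ * u = μ * ((a + 1) * u) := by ring
      _ ≤ μ * (a * (u ^ 2 / 2 + 2)) := mul_le_mul_of_nonneg_left h6 hμ.le
      _ = _ := by ring
  have h7 : μ0 * t ≤ μ0 * (t ^ 2 / 2 + 1 / 2) :=
    mul_le_mul_of_nonneg_left (by nlinarith [sq_nonneg (t - 1)]) hμ0.le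
  nlinarith

theorem le_sq_div_add {s x : ℝ} (hs : 0 < s) : |x| ≤ x ^ 2 / s + s := by
  rw [← sq_abs, div_add' _ _ _ hs.ne', le_div_iff₀ hs]
  nlinarith [sq_nonneg (|x| - s), abs_nonneg x]

theorem sq_sum_le {ι : Type*} [Fintype ι] (u : ι → ℝ) :
    (∑ i, u i) ^ 2 ≤ Fintype.card ι * ∑ i, u i ^ 2 := by
  have := sq_sum_le_card_mul_sum_sq (s := Finset.univ) (f := u)
  simpa using this

/-- The error terms of the drift, which stem from the mismatch of the thresholds and from the
discreteness of the weights. -/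
theorem threshold_error_le {s r T v : ℝ} (hs : 1 ≤ s) (hr : r = s ^ 2) (hT : s ≤ T)
    (hv : 0 ≤ v + r) :
    (4 / T + 4 * ((|v| + 1) / r)) * (v + r) ≤ 16 * (v ^ 2 / s) + 20 * s := by
  have hs0 : 0 < s := by linarith
  have hr0 : 0 < r := by rw [hr]; positivity
  have h1 : 4 / T + 4 * ((|v| + 1) / r) ≤ 8 / s + 4 * |v| / r := by
    have e1 : 4 / T ≤ 4 / s := by gcongr
    have e2 : 4 / r ≤ 4 / s := by
      have : s ≤ r := by rw [hr]; nlinarith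
      gcongr
    have e3 : 4 * ((|v| + 1) / r) = 4 * |v| / r + 4 / r := by ring
    have e4 : 8 / s = 4 / s + 4 / s := by ring
    linarith
  have habs := le_sq_div_add hs0 (x := v)
  have hvr : v + r ≤ |v| + r := by linarith [le_abs_self v]
  calc (4 / T + 4 * ((|v| + 1) / r)) * (v + r)
      ≤ (8 / s + 4 * |v| / r) * (|v| + r) := mul_le_mul h1 hvr hv (by positivity)
    _ = 8 * |v| / s + 8 * s + 4 * (|v| ^ 2 / r) + 4 * |v| := by
        rw [hr]; field_simp; ring
    _ ≤ 8 * |v| + 8 * s + 4 * (v ^ 2 / s) + 4 * |v| := by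
        rw [sq_abs]
        have e1 : 8 * |v| / s ≤ 8 * |v| := div_le_self (by positivity) hs
        have e2 : v ^ 2 / r ≤ v ^ 2 / s := by
          have : s ≤ r := by rw [hr]; nlinarith
          gcongr
        linarith
    _ ≤ _ := by
        have : 0 ≤ v ^ 2 / s := by positivity
        linarith

-- In the application `s = √r`, `V` is the contribution of services to the potential and `b`
-- indicates imbalance. By `|x| ≤ x ^ 2 / s + s`, each linear error splits into a part beaten by the
-- quadratic decay and a remainder `O(s)`.
set_option maxHeartbeats 800000 in
theorem drift_le {I : Type*} [Fintype I] (μ ρ : I → ℝ) (μ0 c₀ κ : ℝ) (hμ : ∀ i, 0 < μ i)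
    (hρ : ∀ i, 0 < ρ i) (hload : ∑ i, ρ i = 1) (hμ0 : 0 < μ0) (hc₀ : 0 < c₀) :
    ∃ a A C : ℝ, 1 ≤ a ∧ 0 < A ∧ 0 < C ∧ ∀ (r s T : ℝ), 1 ≤ s → r = s ^ 2 → s ≤ T →
      ∀ u t : I → ℝ, (∀ i, 0 ≤ t i) → (∀ i, 0 ≤ u i + ρ i * r) →
      ∀ V b : ℝ, 0 ≤ b → b ≤ 1 →
      V ≤ (4 / T + 4 * ((|∑ i, u i| + 1) / r)) * ∑ i, μ i * (u i + ρ i * r)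
        - b * (c₀ * (κ * T - ∑ i, t i)) →
      ∑ i, (μ i * ρ i * r * (A / s * (a * (2 * u i + 1) + (1 - 2 * t i)))
          + μ i * (u i + ρ i * r) * (A / s * (a * (1 - 2 * u i) + (2 * t i + 1)))
          + μ0 * t i * (2 + A / s * (1 - 2 * t i))) + V
        + ((∑ i, (u i ^ 2 + t i ^ 2)) / s + b * (c₀ * κ * T)) ≤ C * s := by
  obtain ⟨Mμ, hMμ⟩ := (Set.finite_range μ).bddAbove
  have hMμ : ∀ i, μ i ≤ Mμ := fun i => hMμ ⟨i, rfl⟩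
  obtain ⟨m, hm, hm0, hmμ⟩ : ∃ m : ℝ, 0 < m ∧ m ≤ μ0 ∧ ∀ i, m ≤ μ i := by
    obtain ⟨j, -, hj⟩ := (Finset.univ : Finset (Option I)).exists_min_image
      (fun o => o.elim μ0 μ) ⟨none, Finset.mem_univ _⟩
    refine ⟨j.elim μ0 μ, ?_, hj none (Finset.mem_univ _), fun i => hj (some i) (Finset.mem_univ _)⟩
    cases j
    · exact hμ0
    · exact hμ _
  set M : ℝ := |Mμ| with hM
  have hM0 : 0 ≤ M := abs_nonneg _
  have hMμ : ∀ i, μ i ≤ M := fun i => (hMμ i).trans (le_abs_self _)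
  set a : ℝ := 1 + 4 * M / μ0 with ha
  have ha1 : 1 ≤ a := by
    have : 0 ≤ 4 * M / μ0 := by positivity
    linarith
  have haμ : ∀ i, 4 * μ i ≤ a * μ0 := by
    intro i
    have : a * μ0 = μ0 + 4 * M := by rw [ha]; field_simp
    linarith [hMμ i]
  set n : ℝ := (Fintype.card I : ℝ) with hn
  have hn0 : 0 ≤ n := Nat.cast_nonneg _
  set C₅ : ℝ := ∑ i, ((2 * a + 2) * μ i * ρ i + 2 * a * μ i + μ0 / 2) with hC₅
  have hC₅0 : 0 ≤ C₅ := Finset.sum_nonneg fun i _ => by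
    have := hμ i; have := hρ i; positivity
  set C₆ : ℝ := (2 * μ0 + c₀) + M * 16 * n with hC₆
  have hC₆0 : 0 ≤ C₆ := by positivity
  -- `C₆` collects the coefficients of `q / s` in all error terms. This `A` makes the decay `(C₆ +
  -- 1) * (q / s)`, which leaves one `q / s` for the conclusion.
  set A : ℝ := (C₆ + 1) / m with hA
  have hA0 : 0 < A := by positivity
  set C₇ : ℝ := (2 * μ0 + c₀) * n + M * 20 with hC₇
  refine ⟨a, A, A * C₅ + C₇ + 1, ha1, hA0, by positivity, ?_⟩
  intro r s T hs hr hT u t ht hu V b hb hb1 hV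
  have hs0 : 0 < s := by linarith
  have hr1 : 1 ≤ r := by rw [hr]; nlinarith
  set q : ℝ := ∑ i, (u i ^ 2 + t i ^ 2) with hq
  have hsumu2 : ∑ i, u i ^ 2 ≤ q := Finset.sum_le_sum fun i _ => by nlinarith [sq_nonneg (t i)]
  have hsumt2 : ∑ i, t i ^ 2 ≤ q := Finset.sum_le_sum fun i _ => by nlinarith [sq_nonneg (u i)]
  have hquad : ∑ i, (μ i * ρ i * r * (a * (2 * u i + 1) + (1 - 2 * t i))
      + μ i * (u i + ρ i * r) * (a * (1 - 2 * u i) + (2 * t i + 1)) + μ0 * t i * (1 - 2 * t i))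
      ≤ -(m * q) + C₅ * r := by
    rw [hq, hC₅, Finset.mul_sum, Finset.sum_mul, ← Finset.sum_neg_distrib,
      ← Finset.sum_add_distrib]
    refine Finset.sum_le_sum fun i _ => ?_
    refine (quadratic_drift_le (hμ i) hμ0 ha1 (haμ i)).trans ?_
    have e1 : m * u i ^ 2 ≤ a * μ i * u i ^ 2 :=
      mul_le_mul_of_nonneg_right ((hmμ i).trans (le_mul_of_one_le_left (hμ i).le ha1))
        (sq_nonneg _)
    have e2 : m * t i ^ 2 ≤ μ0 * t i ^ 2 := mul_le_mul_of_nonneg_right hm0 (sq_nonneg _)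
    have e3 : 2 * a * μ i + μ0 / 2 ≤ (2 * a * μ i + μ0 / 2) * r :=
      le_mul_of_one_le_right (by have := hμ i; positivity) hr1
    nlinarith
  have hdecomp : ∑ i, (μ i * ρ i * r * (A / s * (a * (2 * u i + 1) + (1 - 2 * t i)))
          + μ i * (u i + ρ i * r) * (A / s * (a * (1 - 2 * u i) + (2 * t i + 1)))
          + μ0 * t i * (2 + A / s * (1 - 2 * t i)))
      = A / s * ∑ i, (μ i * ρ i * r * (a * (2 * u i + 1) + (1 - 2 * t i))
      + μ i * (u i + ρ i * r) * (a * (1 - 2 * u i) + (2 * t i + 1)) + μ0 * t i * (1 - 2 * t i))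
        + 2 * μ0 * ∑ i, t i := by
    rw [Finset.mul_sum, Finset.mul_sum, ← Finset.sum_add_distrib]
    exact Finset.sum_congr rfl fun i _ => by ring
  have hmain : A / s * ∑ i, (μ i * ρ i * r * (a * (2 * u i + 1) + (1 - 2 * t i))
      + μ i * (u i + ρ i * r) * (a * (1 - 2 * u i) + (2 * t i + 1)) + μ0 * t i * (1 - 2 * t i))
      ≤ -((C₆ + 1) * (q / s)) + A * C₅ * s := by
    refine (mul_le_mul_of_nonneg_left hquad (by positivity)).trans (le_of_eq ?_)
    rw [hA, hr]
    field_simp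
  have hsumt : ∑ i, t i ≤ q / s + n * s := by
    have : ∑ i, t i ≤ ∑ i, (t i ^ 2 / s + s) := Finset.sum_le_sum fun i _ =>
      (le_abs_self _).trans (le_sq_div_add hs0)
    rw [Finset.sum_add_distrib, ← Finset.sum_div] at this
    have e : (∑ i, t i ^ 2) / s ≤ q / s := by gcongr
    simp only [Finset.sum_const, Finset.card_univ, nsmul_eq_mul] at this
    linarith
  have hsumt0 : 0 ≤ ∑ i, t i := Finset.sum_nonneg fun i _ => ht i
  have hvr : ∑ i, (u i + ρ i * r) = ∑ i, u i + r := by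
    rw [Finset.sum_add_distrib, ← Finset.sum_mul, hload, one_mul]
  have hvr0 : 0 ≤ ∑ i, u i + r := hvr ▸ Finset.sum_nonneg fun i _ => hu i
  have hservice : ∑ i, μ i * (u i + ρ i * r) ≤ M * (∑ i, u i + r) := by
    rw [← hvr, Finset.mul_sum]
    exact Finset.sum_le_sum fun i _ => mul_le_mul_of_nonneg_right (hMμ i) (hu i)
  have hr0 : 0 < r := by linarith
  have hT0 : 0 < T := by linarith
  have herr : (4 / T + 4 * ((|∑ i, u i| + 1) / r)) * ∑ i, μ i * (u i + ρ i * r)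
      ≤ M * (16 * (n * (q / s)) + 20 * s) := by
    calc _ ≤ (4 / T + 4 * ((|∑ i, u i| + 1) / r)) * (M * (∑ i, u i + r)) := by gcongr
      _ = M * ((4 / T + 4 * ((|∑ i, u i| + 1) / r)) * (∑ i, u i + r)) := by ring
      _ ≤ M * (16 * ((∑ i, u i) ^ 2 / s) + 20 * s) := by
          gcongr
          exact threshold_error_le hs hr hT hvr0
      _ ≤ M * (16 * (n * q / s) + 20 * s) := by
          gcongr
          exact (sq_sum_le u).trans (mul_le_mul_of_nonneg_left hsumu2 hn0)
      _ = _ := by ring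
  have hbt : b * (c₀ * ∑ i, t i) ≤ c₀ * ∑ i, t i :=
    mul_le_of_le_one_left (by positivity) hb1
  have hfin : (2 * μ0 + c₀) * ∑ i, t i ≤ (2 * μ0 + c₀) * (q / s + n * s) := by gcongr
  rw [hdecomp]
  have hexp : b * (c₀ * (κ * T - ∑ i, t i)) = b * (c₀ * κ * T) - b * (c₀ * ∑ i, t i) := by ring
  rw [hexp] at hV
  have hgoal : -((C₆ + 1) * (q / s)) + A * C₅ * s + (2 * μ0 + c₀) * (q / s + n * s)
      + M * (16 * (n * (q / s)) + 20 * s) + q / s = (A * C₅ + C₇) * s := by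
    rw [hC₆, hC₇]; ring
  have hs' : (A * C₅ + C₇ + 1) * s = (A * C₅ + C₇) * s + s := by ring
  clear_value C₅ C₆ C₇ A a q n M
  linarith

end DriftArithmetic

/-! ### Moment bound in steady state -/

section Stationary

variable {I : Type*} [Fintype I] [DecidableEq I] {K : Finset (I → ℕ)}

theorem numActual_cast (X : State K) (i : I) :
    (numActual X i : ℝ) = ∑ c : completeConfigs K, (c.1.2 i : ℝ) * X c := by
  simp [numActual]

theorem snd_le_fst (c : completeConfigs K) (i : I) : c.1.2 i ≤ c.1.1 i :=
  (mem_serverConfigs.1 (mem_completeConfigs.1 c.2).1).2 i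

theorem numTokens_cast (X : State K) (i : I) :
    (numTokens X i : ℝ) = ∑ c : completeConfigs K, ((c.1.1 i : ℝ) - c.1.2 i) * X c := by
  simp only [numTokens, Nat.cast_sum, Nat.cast_mul]
  exact Finset.sum_congr rfl fun c _ => by rw [Nat.cast_sub (snd_le_fst c i)]

theorem sum_mul_numServers (X : State K) (i : I) :
    ∑ k : nonzeroConfigs K, (k.1 i : ℝ) * numServers X k.1 = numActual X i + numTokens X i := by
  rw [numActual_cast, numTokens_cast, ← Finset.sum_add_distrib]
  simp only [numServers, Nat.cast_sum, Finset.mul_sum]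
  rw [Finset.sum_comm]
  refine Finset.sum_congr rfl fun c _ => ?_
  have hmem : c.1.1 ∈ nonzeroConfigs K := by
    have hc := mem_completeConfigs.1 c.2
    exact Finset.mem_filter.2 ⟨(mem_serverConfigs.1 hc.1).1.1, hc.2⟩
  rw [Finset.sum_eq_single ⟨c.1.1, hmem⟩]
  · simp; ring
  · intro k _ hk
    rw [if_neg fun h => hk (Subtype.ext h.symm)]
    simp
  · simp

theorem shiftedWeight_nonneg {T : ℝ} (hT : 0 ≤ T) (X : State K) (k : I → ℕ) :
    0 ≤ shiftedWeight T X k := fixedWeight_nonneg hT _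

theorem shiftedWeight_le_one (T : ℝ) (X : State K) (k : I → ℕ) : shiftedWeight T X k ≤ 1 :=
  fixedWeight_le_one _ _

theorem shiftedWeight_zero (T : ℝ) (X : State K) : shiftedWeight T X 0 = 0 := by
  simp [shiftedWeight, numServers_zero]

/-- Among the available placements there is one with the least weight difference. -/
theorem exists_best_available (hmono : ∀ k ∈ K, ∀ k' : I → ℕ, k' ≤ k → k' ∈ K)
    (hunit : ∀ i : I, (Pi.single i 1 : I → ℕ) ∈ K) (T : ℝ) (X : State K) (i : I) :
    ∃ j, Available X i j ∧ ∀ j', Available X i j' →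
      shiftedWeight T X (j + Pi.single i 1) - shiftedWeight T X j
        ≤ shiftedWeight T X (j' + Pi.single i 1) - shiftedWeight T X j' := by
  classical
  have hmem : ∀ j, Available X i j → j ∈ K.filter (Available X i) := fun j hj =>
    Finset.mem_filter.2 ⟨hmono _ hj.1 _ fun l => Nat.le_add_right _ _, hj⟩
  have h0 : Available X i 0 := ⟨by simpa using hunit i, Or.inl rfl⟩
  obtain ⟨j, hj, hmin⟩ := (K.filter (Available X i)).exists_min_image
    (fun j => shiftedWeight T X (j + Pi.single i 1) - shiftedWeight T X j) ⟨0, hmem 0 h0⟩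
  exact ⟨j, (Finset.mem_filter.1 hj).2, fun j' hj' => hmin j' (hmem j' hj')⟩

/-- The squared deviation of the customer and token counts from their equilibrium values. -/
def deviation (ρ : I → ℝ) (r : ℝ) (X : State K) : ℝ :=
  ∑ i, (((numActual X i : ℝ) - ρ i * r) ^ 2 + (numTokens X i : ℝ) ^ 2)

/-- The configurations with saturated weight admit a dual certificate. -/
def IsBalanced (T : ℝ) (X : State K) : Prop :=
  HasDualCertificate K {k | shiftedWeight T X k = 1}

theorem deviation_nonneg (ρ : I → ℝ) (r : ℝ) (X : State K) : 0 ≤ deviation ρ r X :=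
  Finset.sum_nonneg fun _ _ => by positivity

/-- In an unbalanced state the services improve the potential at a rate of order `T`. -/
theorem exists_service_gain (hmono : ∀ k ∈ K, ∀ k' : I → ℕ, k' ≤ k → k' ∈ K)
    {mu : I → ℝ} (hmu : ∀ i, 0 < mu i) :
    ∃ c₀ κ : ℝ, 0 < c₀ ∧ 0 < κ ∧ ∀ (T : ℝ) (X : State K) (J : I → I → ℕ), 0 < T →
      (∀ i, ∀ j', Available X i j' →
        shiftedWeight T X (J i + Pi.single i 1) - shiftedWeight T X (J i)
          ≤ shiftedWeight T X (j' + Pi.single i 1) - shiftedWeight T X j') →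
      ¬ IsBalanced T X →
      c₀ * (κ * T - ∑ i, (numTokens X i : ℝ)) ≤
        ∑ i, ∑ c : completeConfigs K, mu i * (c.1.2 i : ℝ) * (X c : ℝ) *
          max 0 (shiftedWeight T X c.1.1 - shiftedWeight T X (c.1.1 - Pi.single i 1)
            - (shiftedWeight T X (J i + Pi.single i 1) - shiftedWeight T X (J i))) := by
  obtain ⟨ε, κ, hε, hκ, himp⟩ := exists_improvable K hmono
  obtain ⟨m, hm, hmmu⟩ : ∃ m : ℝ, 0 < m ∧ ∀ i, m ≤ mu i := by
    obtain ⟨j, -, hj⟩ := (Finset.univ : Finset (Option I)).exists_min_image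
      (fun o => o.elim 1 mu) ⟨none, Finset.mem_univ _⟩
    refine ⟨j.elim 1 mu, ?_, fun i => hj (some i) (Finset.mem_univ _)⟩
    cases j
    · exact one_pos
    · exact hmu _
  refine ⟨m * ε, κ, by positivity, hκ, ?_⟩
  intro T X J hT hJ hbad
  have hw0 := fun k => shiftedWeight_nonneg hT.le X k
  have hw1 := fun k => shiftedWeight_le_one T X k
  obtain ⟨k, hkK, i, hki, hκk, hεk⟩ := himp (shiftedWeight T X)
    (fun i => shiftedWeight T X (J i + Pi.single i 1) - shiftedWeight T X (J i))
    (shiftedWeight_zero T X) hw0 hw1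
    (fun i => abs_le.2 ⟨by linarith [hw0 (J i + Pi.single i 1), hw1 (J i)],
      by linarith [hw1 (J i + Pi.single i 1), hw0 (J i)]⟩)
    -- A positive shifted weight means at least two servers, exactly what `Available` requires.
    (fun i j hjK hj => hJ i j ⟨hjK, hj.imp id fun h => by
      by_contra hlt
      have : numServers X j - 1 = 0 := by omega
      simp [shiftedWeight, this] at h⟩) hbad
  set gain : I → completeConfigs K → ℝ := fun i c =>
    max 0 (shiftedWeight T X c.1.1 - shiftedWeight T X (c.1.1 - Pi.single i 1)
      - (shiftedWeight T X (J i + Pi.single i 1) - shiftedWeight T X (J i))) with hgain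
  have hterm0 : ∀ i, ∀ c : completeConfigs K,
      0 ≤ mu i * (c.1.2 i : ℝ) * (X c : ℝ) * gain i c := fun i c => by
    have := hmu i
    have : 0 ≤ gain i c := le_max_left _ _
    positivity
  -- Weight at least `κ` means at least `κ * T` servers; all but at most `numTokens X i` of them
  -- hold an actual customer of type `i`.
  have hN : κ * T ≤ numServers X k := by
    have h1 : shiftedWeight T X k ≤ ((numServers X k - 1 : ℕ) : ℝ) / T := min_le_right _ _
    have h2 : ((numServers X k - 1 : ℕ) : ℝ) ≤ numServers X k := by
      exact_mod_cast Nat.sub_le _ _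
    have h3 := hκk.trans h1
    rw [le_div_iff₀ hT] at h3
    linarith
  have htok : (numTokens X i : ℝ) ≤ ∑ i, (numTokens X i : ℝ) :=
    Finset.single_le_sum (f := fun i => (numTokens X i : ℝ)) (fun _ _ => Nat.cast_nonneg _)
      (Finset.mem_univ i)
  have hcount : (numServers X k : ℝ) ≤
      ∑ c : completeConfigs K, (if c.1.1 = k then (c.1.2 i : ℝ) * X c else 0) + numTokens X i := by
    have := numServers_le_sum_add_numTokens X hki
    have : (numServers X k : ℝ) ≤ ((∑ c : completeConfigs K,
      (if c.1.1 = k then c.1.2 i * X c else 0) + numTokens X i : ℕ) : ℝ) := by exact_mod_cast this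
    push_cast at this
    exact this
  calc m * ε * (κ * T - ∑ i, (numTokens X i : ℝ))
      ≤ m * ε * ∑ c : completeConfigs K, (if c.1.1 = k then (c.1.2 i : ℝ) * X c else 0) := by
        refine mul_le_mul_of_nonneg_left ?_ (by positivity)
        linarith
    _ ≤ ∑ c : completeConfigs K, mu i * (c.1.2 i : ℝ) * (X c : ℝ) * gain i c := by
        rw [Finset.mul_sum]
        refine Finset.sum_le_sum fun c _ => ?_
        split_ifs with hc
        · have h1 : ε ≤ gain i c := by
            simp only [hgain, hc]
            exact hεk.trans (le_max_right _ _)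
          calc m * ε * ((c.1.2 i : ℝ) * X c) ≤ mu i * gain i c * ((c.1.2 i : ℝ) * X c) := by
                refine mul_le_mul_of_nonneg_right ?_ (by positivity)
                exact mul_le_mul (hmmu i) h1 hε.le (hmu i).le
            _ = _ := by ring
        · rw [mul_zero]
          exact hterm0 i c
    _ ≤ _ := Finset.single_le_sum
        (f := fun i => ∑ c : completeConfigs K, mu i * (c.1.2 i : ℝ) * (X c : ℝ) * gain i c)
        (fun i _ => Finset.sum_nonneg fun c _ => hterm0 i c) (Finset.mem_univ i)

/-- The events of the chain: arrivals, service completions and token expirations. -/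
abbrev Event (K : Finset (I → ℕ)) := I × (Unit ⊕ completeConfigs K ⊕ completeConfigs K)

/-- The rate of an event. -/
def eventRate (lam mu : I → ℝ) (mu0 r : ℝ) (X : State K) : Event K → ℝ
  | (i, .inl _) => lam i * r
  | (i, .inr (.inl c)) => mu i * (c.1.2 i : ℝ) * (X c : ℝ)
  | (i, .inr (.inr c)) => mu0 * ((c.1.1 i : ℝ) - (c.1.2 i : ℝ)) * (X c : ℝ)

/-- The law of the state right after an event. -/
def eventLaw {p : ℝ} (P : GSSMPolicy K p) (X : State K) : Event K → PMF (State K)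
  | (i, .inl _) => P.afterArrival X i
  | (i, .inr (.inl c)) => P.afterService X c.1 i
  | (i, .inr (.inr c)) => GSSMPolicy.afterTimeout X c.1 i

theorem sum_event (F : Event K → ℝ) : ∑ e, F e =
    ∑ i, (F (i, .inl ()) + ∑ c, F (i, .inr (.inl c)) + ∑ c, F (i, .inr (.inr c))) := by
  simp [Fintype.sum_prod_type, add_assoc]

theorem rate_eq_sum_event {p : ℝ} (P : GSSMPolicy K p) (lam mu : I → ℝ) (mu0 r : ℝ)
    (X Y : State K) : P.rate lam mu mu0 r X Y
      = ∑ e, ENNReal.ofReal (eventRate lam mu mu0 r X e) * eventLaw P X e Y := by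
  simp [GSSMPolicy.rate, Fintype.sum_prod_type, add_assoc, eventRate, eventLaw]

/-- The main moment bound: in steady state the deviations are of order `√r`, and unbalanced states
are unlikely. -/
theorem exists_stationary_bound (hmono : ∀ k ∈ K, ∀ k' : I → ℕ, k' ≤ k → k' ∈ K)
    (hunit : ∀ i : I, (Pi.single i 1 : I → ℕ) ∈ K)
    {lam mu : I → ℝ} {mu0 : ℝ} (hlam : ∀ i, 0 < lam i) (hmu : ∀ i, 0 < mu i) (hmu0 : 0 < mu0)
    {ρ : I → ℝ} (hρ : ∀ i, ρ i = lam i / mu i) (hload : ∑ i, ρ i = 1)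
    {p : ℝ} (hp : 1 / 2 < p) (hp1 : p < 1) :
    ∃ c C : ℝ, 0 < c ∧ 0 < C ∧ ∀ (r : ℝ), 1 ≤ r → ∀ (P : GSSMPolicy K p)
      (π : Measure (State K)) [IsProbabilityMeasure π], P.IsStationary lam mu mu0 r π →
      ∫⁻ X, ENNReal.ofReal (deviation ρ r X / √r
        + Set.indicator {X | ¬ IsBalanced (r ^ p) X} (fun _ => 1) X * (c * r ^ p)) ∂π
        ≤ ENNReal.ofReal (C * √r) := by
  classical
  obtain ⟨c₀, κ, hc₀, hκ, hgain⟩ := exists_service_gain hmono hmu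
  have hρ0 : ∀ i, 0 < ρ i := fun i => by rw [hρ]; exact div_pos (hlam i) (hmu i)
  obtain ⟨a, A, C, ha, hA, hC, hdrift⟩ := drift_le mu ρ mu0 c₀ κ hmu hρ0 hload hmu0 hc₀
  refine ⟨c₀ * κ, C, by positivity, hC, ?_⟩
  intro r hr P π _ hπ
  have hr0 : 0 < r := by linarith
  set T : ℝ := r ^ p with hT
  have hT0 : 0 < T := Real.rpow_pos_of_pos hr0 p
  set s : ℝ := √r with hs
  have hs1 : 1 ≤ s := Real.one_le_sqrt.2 hr
  have hrs : r = s ^ 2 := (Real.sq_sqrt hr0.le).symm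
  -- The discretization error is of order `1 / T` per service at a rate of order `r`. With `p > 1/2`
  -- it is no larger than the natural fluctuation `√r`.
  have hsT : s ≤ T := by
    rw [hs, hT, Real.sqrt_eq_rpow]
    exact Real.rpow_le_rpow_of_exponent_le hr hp.le
  have hs0 : 0 < s := by linarith
  have hp0 : 0 < p := by linarith
  choose J hJav hJmin using exists_best_available hmono hunit T
  set m : I → ℝ := fun i => ρ i * r with hm
  set h : ℝ := A / s with hh
  have hh0 : 0 < h := by positivity
  set δ : State K → ℝ := fun X => 4 / T + 4 * ((|(totalActual X : ℝ) - r| + 1) / r) with hδ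
  set G : State K → I → completeConfigs K → ℝ := fun X i c =>
    max 0 (shiftedWeight T X c.1.1 - shiftedWeight T X (c.1.1 - Pi.single i 1)
      - (shiftedWeight T X (J X i + Pi.single i 1) - shiftedWeight T X (J X i))) with hG
  set S : State K → Event K → ℝ := fun X e => match e with
    | (i, .inl _) => h * (a * (2 * (numActual X i - m i) + 1) + (1 - 2 * numTokens X i))
    | (i, .inr (.inl c)) => -G X i c + δ X
        + h * (a * (1 - 2 * (numActual X i - m i)) + (2 * numTokens X i + 1))
    | (i, .inr (.inr _)) => 2 + h * (1 - 2 * numTokens X i) with hS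
  refine lintegral_le_of_event_drift π (eventRate lam mu mu0 r) ?_ (eventLaw P) ?_
    (lyapunov T h a m) (finite_lyapunov_lt hT0.le hh0 ha m) S ?_ _ ?_ _ ?_
  · rintro X ⟨i, _ | c | c⟩
    · exact mul_nonneg (hlam i).le hr0.le
    · have := hmu i
      simp only [eventRate]
      positivity
    · have : (c.1.2 i : ℝ) ≤ c.1.1 i := by exact_mod_cast snd_le_fst c i
      exact mul_nonneg (mul_nonneg hmu0.le (by linarith)) (Nat.cast_nonneg _)
  · intro Y
    simpa only [rate_eq_sum_event] using hπ Y
  · rintro X ⟨i, _ | c | c⟩ hne Y hY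
    · exact lyapunov_afterArrival_le hmono hT0.le hh0.le m P X i Y hY
    · have hX : 0 < X c := Nat.pos_of_ne_zero fun h0 => hne (by simp [eventRate, h0])
      have hi : 0 < c.1.2 i := Nat.pos_of_ne_zero fun h0 => hne (by simp [eventRate, h0])
      exact lyapunov_afterService_le hmono hp0 hp1.le hr0 m P hX hi hY (hJav X i)
    · have hX : 0 < X c := Nat.pos_of_ne_zero fun h0 => hne (by simp [eventRate, h0])
      have hi : c.1.2 i < c.1.1 i := lt_of_le_of_ne (snd_le_fst c i) fun h0 =>
        hne (by simp [eventRate, h0])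
      have hYeq : Y = move X c.1 (c.1.1 - Pi.single i 1, c.1.2) := by
        simpa [eventLaw, GSSMPolicy.afterTimeout] using hY
      rw [hYeq]
      exact lyapunov_afterTimeout_le hmono hT0.le m hX hi
  · intro X
    have := deviation_nonneg ρ r X
    have : 0 ≤ Set.indicator {X | ¬ IsBalanced T X} (fun _ => (1 : ℝ)) X :=
      Set.indicator_nonneg (fun _ _ => zero_le_one) _
    positivity
  · intro X
    have hZ : (totalActual X : ℝ) - r = ∑ i, ((numActual X i : ℝ) - m i) := by
      rw [Finset.sum_sub_distrib, hm, ← Finset.sum_mul, hload, one_mul]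
      simp [totalActual]
    have hb0 : 0 ≤ Set.indicator {X | ¬ IsBalanced T X} (fun _ => (1 : ℝ)) X :=
      Set.indicator_nonneg (fun _ _ => zero_le_one) _
    have hb1 : Set.indicator {X | ¬ IsBalanced T X} (fun _ => (1 : ℝ)) X ≤ 1 :=
      Set.indicator_le_self' (fun _ _ => zero_le_one) _
    have key := hdrift r s T hs1 hrs hsT (fun i => (numActual X i : ℝ) - m i)
      (fun i => (numTokens X i : ℝ)) (fun i => Nat.cast_nonneg _)
      (fun i => by simp [hm])
      (∑ i, ∑ c : completeConfigs K, mu i * (c.1.2 i : ℝ) * (X c : ℝ) * (-G X i c + δ X))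
      (Set.indicator {X | ¬ IsBalanced T X} (fun _ => (1 : ℝ)) X) hb0 hb1 ?_
    · refine le_trans (le_of_eq ?_) key
      rw [sum_event]
      congr 1
      rw [← Finset.sum_add_distrib]
      refine Finset.sum_congr rfl fun i _ => ?_
      have hl : lam i = mu i * ρ i := by rw [hρ]; field_simp [(hmu i).ne']
      simp only [eventRate, hS]
      have e1 : ∀ x y : ℝ, ∑ c : completeConfigs K, mu i * (c.1.2 i : ℝ) * (X c : ℝ)
          * (-G X i c + x + y) = ∑ c : completeConfigs K, mu i * (c.1.2 i : ℝ) * (X c : ℝ)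
          * (-G X i c + x) + mu i * numActual X i * y := by
        intro x y
        rw [numActual_cast, Finset.mul_sum, Finset.sum_mul, ← Finset.sum_add_distrib]
        exact Finset.sum_congr rfl fun c _ => by ring
      have e2 : ∀ x : ℝ, ∑ c : completeConfigs K, mu0 * ((c.1.1 i : ℝ) - c.1.2 i) * (X c : ℝ) * x
          = mu0 * numTokens X i * x := by
        intro x
        rw [numTokens_cast, Finset.mul_sum, Finset.sum_mul]
        exact Finset.sum_congr rfl fun c _ => by ring
      rw [e1, e2, hl]
      simp only [hm]
      ring
    · have e3 : ∑ i, ∑ c : completeConfigs K, mu i * (c.1.2 i : ℝ) * (X c : ℝ) * (-G X i c + δ X)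
          = δ X * ∑ i, mu i * ((numActual X i : ℝ) - m i + ρ i * r)
            - ∑ i, ∑ c : completeConfigs K, mu i * (c.1.2 i : ℝ) * (X c : ℝ) * G X i c := by
        rw [Finset.mul_sum, ← Finset.sum_sub_distrib]
        refine Finset.sum_congr rfl fun i _ => ?_
        rw [hm, sub_add_cancel, numActual_cast, Finset.mul_sum, Finset.mul_sum,
          ← Finset.sum_sub_distrib]
        exact Finset.sum_congr rfl fun c _ => by ring
      rw [e3, ← hZ]
      refine sub_le_sub_left ?_ _
      by_cases hbal : IsBalanced T X
      · rw [Set.indicator_of_notMem (by simpa using hbal), zero_mul]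
        refine Finset.sum_nonneg fun i _ => Finset.sum_nonneg fun c _ => ?_
        have := hmu i
        have : 0 ≤ G X i c := le_max_left _ _
        positivity
      · rw [Set.indicator_of_mem (by simpa using hbal), one_mul]
        exact hgain T X (J X) hT0 (hJmin X) hbal

end Stationary

/-! ### Typical states and the limit -/

section Conclusion

variable {I : Type*} [Fintype I] [DecidableEq I] {K : Finset (I → ℕ)}

/-- The states which are balanced and whose deviation is at most `r ^ (p + 1 / 2)`. -/
def typicalStates (K : Finset (I → ℕ)) (ρ : I → ℝ) (p r : ℝ) : Set (State K) :=
  {X | IsBalanced (r ^ p) X ∧ deviation ρ r X ≤ r ^ (p + 1 / 2)}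

/-- Markov's inequality at a level of order `r ^ p` against a mean of order `√r` leaves probability
`O(r ^ (1/2 - p))` for atypical states. The cutoff `r ^ (p + 1/2)` lies between the mean order `r`
of the deviation and `r ^ (2 * p)`. -/
theorem tendsto_measure_typicalStates (hmono : ∀ k ∈ K, ∀ k' : I → ℕ, k' ≤ k → k' ∈ K)
    (hunit : ∀ i : I, (Pi.single i 1 : I → ℕ) ∈ K)
    {lam mu : I → ℝ} {mu0 : ℝ} (hlam : ∀ i, 0 < lam i) (hmu : ∀ i, 0 < mu i) (hmu0 : 0 < mu0)
    {ρ : I → ℝ} (hρ : ∀ i, ρ i = lam i / mu i) (hload : ∑ i, ρ i = 1)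
    {p : ℝ} (hp : 1 / 2 < p) (hp1 : p < 1) {r : ℕ → ℝ} (hr : Tendsto r atTop atTop)
    (P : ℕ → GSSMPolicy K p) (π : ℕ → Measure (State K)) [∀ n, IsProbabilityMeasure (π n)]
    (hπ : ∀ n, (P n).IsStationary lam mu mu0 (r n) (π n)) :
    Tendsto (fun n => π n (typicalStates K ρ p (r n))) atTop (𝓝 1) := by
  obtain ⟨c, C, hc, hC, hbound⟩ := exists_stationary_bound hmono hunit hlam hmu hmu0 hρ hload hp hp1
  set c₁ : ℝ := min c 1 with hc₁
  have hc₁0 : 0 < c₁ := lt_min hc one_pos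
  have hcompl : ∀ᶠ n in atTop, π n (typicalStates K ρ p (r n))ᶜ
      ≤ ENNReal.ofReal (C / c₁ * r n ^ (1 / 2 - p)) := by
    filter_upwards [hr.eventually_ge_atTop 1] with n hn
    have hr0 : 0 < r n := by linarith
    have hT : 0 < r n ^ p := Real.rpow_pos_of_pos hr0 p
    have hs : √(r n) = r n ^ (1 / 2 : ℝ) := Real.sqrt_eq_rpow _
    have hs0 : 0 < √(r n) := Real.sqrt_pos.2 hr0
    -- An atypical state either has deviation above `r ^ p * √r` or pays the imbalance term; `c₁`
    -- covers both.
    have hsub : (typicalStates K ρ p (r n))ᶜ ⊆ {X | ENNReal.ofReal (c₁ * r n ^ p) ≤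
        ENNReal.ofReal (deviation ρ (r n) X / √(r n)
          + Set.indicator {X | ¬ IsBalanced (r n ^ p) X} (fun _ => 1) X * (c * r n ^ p))} := by
      intro X hX
      refine ENNReal.ofReal_le_ofReal ?_
      have hdev := deviation_nonneg ρ (r n) X
      by_cases hbal : IsBalanced (r n ^ p) X
      · have hlt : r n ^ (p + 1 / 2) < deviation ρ (r n) X := by
          by_contra hle
          exact hX ⟨hbal, not_lt.1 hle⟩
        rw [Set.indicator_of_notMem (by simpa using hbal), zero_mul, add_zero,
          le_div_iff₀ hs0, hs]
        rw [Real.rpow_add hr0] at hlt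
        have h1 : c₁ ≤ 1 := min_le_right _ _
        have h2 : 0 < r n ^ p * r n ^ (1 / 2 : ℝ) := mul_pos hT (hs ▸ hs0)
        nlinarith
      · rw [Set.indicator_of_mem (by simpa using hbal), one_mul]
        have h1 : c₁ * r n ^ p ≤ c * r n ^ p :=
          mul_le_mul_of_nonneg_right (min_le_left _ _) hT.le
        have h2 : 0 ≤ deviation ρ (r n) X / √(r n) := by positivity
        linarith
    have hmarkov := mul_meas_ge_le_lintegral₀ (μ := π n)
      (f := fun X => ENNReal.ofReal (deviation ρ (r n) X / √(r n)
          + Set.indicator {X | ¬ IsBalanced (r n ^ p) X} (fun _ => 1) X * (c * r n ^ p)))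
      (measurable_of_countable _).aemeasurable (ENNReal.ofReal (c₁ * r n ^ p))
    have hpos : 0 < c₁ * r n ^ p := by positivity
    have h1 := (mul_le_mul_right (measure_mono hsub) _).trans
      (hmarkov.trans (hbound (r n) hn (P n) (π n) (hπ n)))
    have h2 : C / c₁ * r n ^ (1 / 2 - p) = C * √(r n) / (c₁ * r n ^ p) := by
      rw [Real.rpow_sub hr0, hs]; field_simp
    rw [h2, ENNReal.ofReal_div_of_pos hpos,
      ENNReal.le_div_iff_mul_le (Or.inl (by simpa using hpos)) (Or.inl ENNReal.ofReal_ne_top),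
      mul_comm]
    exact h1
  have hlim : Tendsto (fun n => ENNReal.ofReal (C / c₁ * r n ^ (1 / 2 - p))) atTop (𝓝 0) := by
    have h1 : Tendsto (fun n => r n ^ (-(p - 1 / 2))) atTop (𝓝 0) :=
      (tendsto_rpow_neg_atTop (by linarith)).comp hr
    have h2 := ENNReal.tendsto_ofReal (h1.const_mul (C / c₁))
    simpa using h2
  have hzero : Tendsto (fun n => π n (typicalStates K ρ p (r n))ᶜ) atTop (𝓝 0) :=
    tendsto_of_tendsto_of_tendsto_of_le_of_le' tendsto_const_nhds hlim
      (Eventually.of_forall fun _ => zero_le) hcompl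
  have hone := ENNReal.Tendsto.sub (tendsto_const_nhds (x := (1 : ENNReal))) hzero
    (Or.inl ENNReal.one_ne_top)
  rw [tsub_zero] at hone
  refine hone.congr fun n => ?_
  rw [prob_compl_eq_one_sub (Set.to_countable _).measurableSet]
  exact ENNReal.sub_sub_cancel ENNReal.one_ne_top prob_le_one

theorem abs_le_of_mem_typicalStates {ρ : I → ℝ} {p r : ℝ} (hr : 1 ≤ r) {X : State K}
    (hX : X ∈ typicalStates K ρ p r) (i : I) :
    |(numActual X i : ℝ) - ρ i * r| ≤ r ^ ((p + 1 / 2) / 2) ∧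
      (numTokens X i : ℝ) ≤ r ^ ((p + 1 / 2) / 2) := by
  have hr0 : 0 < r := by linarith
  have hsq : r ^ (p + 1 / 2) = (r ^ ((p + 1 / 2) / 2)) ^ 2 := by
    rw [← Real.rpow_natCast, ← Real.rpow_mul hr0.le]
    norm_num
  have h1 : ((numActual X i : ℝ) - ρ i * r) ^ 2 + (numTokens X i : ℝ) ^ 2
      ≤ (r ^ ((p + 1 / 2) / 2)) ^ 2 := by
    refine le_trans ?_ (hX.2.trans hsq.le)
    exact Finset.single_le_sum
      (f := fun i => ((numActual X i : ℝ) - ρ i * r) ^ 2 + (numTokens X i : ℝ) ^ 2)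
      (fun _ _ => by positivity) (Finset.mem_univ i)
  have h0 : 0 ≤ r ^ ((p + 1 / 2) / 2) := by positivity
  refine ⟨abs_le_of_sq_le_sq ?_ h0, ?_⟩
  · nlinarith [sq_nonneg (numTokens X i : ℝ)]
  · refine le_of_sq_le_sq ?_ h0
    nlinarith [sq_nonneg ((numActual X i : ℝ) - ρ i * r)]

theorem exists_distToOptimal_le (hunit : ∀ i : I, (Pi.single i 1 : I → ℕ) ∈ K)
    {ρ : I → ℝ} (hρ : ∀ i, 0 ≤ ρ i) {p : ℝ} (hp : 1 / 2 < p) :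
    ∃ C : ℝ, 0 < C ∧ ∀ r : ℝ, 1 ≤ r → ∀ X ∈ typicalStates K ρ p r,
      distToOptimal ρ r X ≤ C * r ^ (p - 1) := by
  obtain ⟨C, hC, hdist⟩ := exists_infDist_lpOptimal_le hunit hρ
  refine ⟨C * 2, by positivity, fun r hr X hX => ?_⟩
  have hr0 : 0 < r := by linarith
  have hT : 0 < r ^ p := Real.rpow_pos_of_pos hr0 p
  have hT1 : 1 ≤ r ^ p := Real.one_le_rpow hr (by linarith)
  -- The value `2 * r ^ p` bounds both errors before scaling: customers and tokens each contribute
  -- at most `r ^ p` to the load error, and an unsaturated count satisfies `X_k - 1 < r ^ p` with `1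
  -- ≤ r ^ p`.
  have hβ : 2 * r ^ (p - 1) = 2 * r ^ p / r := by
    rw [Real.rpow_sub hr0, Real.rpow_one]; ring
  rw [mul_assoc]
  refine hdist _ (2 * r ^ (p - 1)) (by positivity) (fun k => by positivity) (fun i => ?_)
    {k | shiftedWeight (r ^ p) X k = 1} hX.1 (fun k hk => ?_)
  · have h1 : ∑ k : nonzeroConfigs K, (k.1 i : ℝ) * ((numServers X k.1 : ℝ) / r) - ρ i
        = ((numActual X i - ρ i * r) + numTokens X i) / r := by
      simp only [mul_div_assoc', ← Finset.sum_div]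
      rw [sum_mul_numServers]
      field_simp
      ring
    obtain ⟨h2, h3⟩ := abs_le_of_mem_typicalStates hr hX i
    have h4 : r ^ ((p + 1 / 2) / 2) ≤ r ^ p :=
      Real.rpow_le_rpow_of_exponent_le hr (by linarith)
    rw [h1, abs_div, abs_of_pos hr0, hβ]
    gcongr
    refine (abs_add_le _ _).trans ?_
    rw [Nat.abs_cast]
    linarith
  · rw [hβ]
    gcongr
    have h1 : ((numServers X k.1 - 1 : ℕ) : ℝ) < r ^ p := by
      by_contra! hle
      refine hk (min_eq_left ?_)
      rwa [one_le_div hT]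
    have h2 : (numServers X k.1 : ℝ) ≤ ((numServers X k.1 - 1 : ℕ) : ℝ) + 1 := by
      exact_mod_cast (by omega : numServers X k.1 ≤ numServers X k.1 - 1 + 1)
    linarith

theorem tendsto_measure_of_eventually_subset {S : Type*} [MeasurableSpace S] (π : ℕ → Measure S)
    [∀ n, IsProbabilityMeasure (π n)] {A B : ℕ → Set S}
    (hA : Tendsto (fun n => π n (A n)) atTop (𝓝 1)) (hAB : ∀ᶠ n in atTop, A n ⊆ B n) :
    Tendsto (fun n => π n (B n)) atTop (𝓝 1) :=
  tendsto_of_tendsto_of_tendsto_of_le_of_le' hA tendsto_const_nhds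
    (hAB.mono fun _ h => measure_mono h) (Eventually.of_forall fun _ => prob_le_one)

end Conclusion

end GSSPacking

end

open GSSPacking
theorem mainTheorem2 {I : Type*} [Fintype I] [DecidableEq I]
    (K : Finset (I → ℕ))
    (hmono : ∀ k ∈ K, ∀ k' : I → ℕ, k' ≤ k → k' ∈ K)
    (hunit : ∀ i : I, (Pi.single i 1 : I → ℕ) ∈ K)
    (lam mu : I → ℝ) (mu0 : ℝ)
    (hlam : ∀ i, 0 < lam i) (hmu : ∀ i, 0 < mu i) (hmu0 : 0 < mu0)
    (ρ : I → ℝ) (hρ : ∀ i, ρ i = lam i / mu i) (hload : ∑ i, ρ i = 1)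
    (p : ℝ) (hp : 1 / 2 < p) (hp1 : p < 1) :
    ∃ C : ℝ, 0 < C ∧
      ∀ (r : ℕ → ℝ), (∀ n, 0 < r n) → Tendsto r atTop atTop →
      ∀ (P : ℕ → GSSMPolicy K p) (π : ℕ → Measure (State K)) [∀ n, IsProbabilityMeasure (π n)],
      (∀ n, (P n).IsStationary lam mu mu0 (r n) (π n)) →
        Tendsto (fun n => π n {X | distToOptimal ρ (r n) X ≤ C * r n ^ (p - 1)}) atTop (𝓝 1) ∧
        TendstoInDistribution
          (fun n (X : State K) => r n ^ (-p) * ∑ i, (numTokens X i : ℝ))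
          atTop (fun _ : Unit => (0 : ℝ)) π (Measure.dirac ()) ∧
        TendstoInDistribution
          (fun n (X : State K) => distToOptimal ρ (r n) X)
          atTop (fun _ : Unit => (0 : ℝ)) π (Measure.dirac ()) ∧
        TendstoInDistribution
          (fun n (X : State K) => (r n)⁻¹ * ∑ i, (numTokens X i : ℝ))
          atTop (fun _ : Unit => (0 : ℝ)) π (Measure.dirac ()) := by
  have hρ0 : ∀ i, 0 ≤ ρ i := fun i => by rw [hρ]; exact (div_pos (hlam i) (hmu i)).le
  obtain ⟨C, hC, hdist⟩ := exists_distToOptimal_le hunit hρ0 hp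
  refine ⟨C, hC, fun r hr0 hr P π _ hπ => ?_⟩
  have htyp := tendsto_measure_typicalStates hmono hunit hlam hmu hmu0 hρ hload hp hp1 hr P π hπ
  have hr1 : ∀ᶠ n in atTop, 1 ≤ r n := hr.eventually_ge_atTop 1
  -- On typical states each token count is at most `r ^ ((p + 1/2) / 2)`, which is `o(r ^ p)`
  -- because `p > 1/2`.
  have htok : ∀ n, 1 ≤ r n → ∀ X ∈ typicalStates K ρ p (r n),
      |r n ^ (-p) * ∑ i, (numTokens X i : ℝ)| ≤ Fintype.card I * r n ^ (-((p - 1 / 2) / 2)) := by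
    intro n hn X hX
    have hsum : ∑ i, (numTokens X i : ℝ) ≤ Fintype.card I * r n ^ ((p + 1 / 2) / 2) := by
      have := Finset.sum_le_card_nsmul Finset.univ (fun i => (numTokens X i : ℝ)) _
        fun i _ => (abs_le_of_mem_typicalStates hn hX i).2
      simpa using this
    have hpow : 0 < r n ^ (-p) := Real.rpow_pos_of_pos (hr0 n) _
    rw [abs_of_nonneg (by positivity)]
    calc r n ^ (-p) * ∑ i, (numTokens X i : ℝ)
        ≤ r n ^ (-p) * (Fintype.card I * r n ^ ((p + 1 / 2) / 2)) := by gcongr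
      _ = Fintype.card I * (r n ^ (-p) * r n ^ ((p + 1 / 2) / 2)) := by ring
      _ = _ := by rw [← Real.rpow_add (hr0 n)]; ring_nf
  have htoklim : Tendsto (fun n => (Fintype.card I : ℝ) * r n ^ (-((p - 1 / 2) / 2))) atTop
      (𝓝 0) := by
    have := ((tendsto_rpow_neg_atTop (y := (p - 1 / 2) / 2) (by linarith)).comp hr).const_mul
      (Fintype.card I : ℝ)
    simpa using this
  have hdistlim : Tendsto (fun n => C * r n ^ (p - 1)) atTop (𝓝 0) := by
    have := ((tendsto_rpow_neg_atTop (y := 1 - p) (by linarith)).comp hr).const_mul C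
    simpa using this
  refine ⟨?_, ?_, ?_, ?_⟩
  · exact tendsto_measure_of_eventually_subset π htyp
      (hr1.mono fun n hn X hX => hdist (r n) hn X hX)
  · refine tendstoInDistribution_zero π _ (fun n => measurable_of_countable _) fun ε hε => ?_
    refine tendsto_measure_of_eventually_subset π htyp ?_
    filter_upwards [hr1, htoklim.eventually_le_const hε] with n hn hle X hX
    exact (htok n hn X hX).trans hle
  · refine tendstoInDistribution_zero π _ (fun n => measurable_of_countable _) fun ε hε => ?_
    refine tendsto_measure_of_eventually_subset π htyp ?_
    filter_upwards [hr1, hdistlim.eventually_le_const hε] with n hn hle X hX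
    have hnn : 0 ≤ distToOptimal ρ (r n) X := Metric.infDist_nonneg
    change |distToOptimal ρ (r n) X| ≤ ε
    rw [abs_of_nonneg hnn]
    exact (hdist (r n) hn X hX).trans hle
  · refine tendstoInDistribution_zero π _ (fun n => measurable_of_countable _) fun ε hε => ?_
    refine tendsto_measure_of_eventually_subset π htyp ?_
    filter_upwards [hr1, htoklim.eventually_le_const hε] with n hn hle X hX
    refine le_trans ?_ ((htok n hn X hX).trans hle)
    have hsum : 0 ≤ ∑ i, (numTokens X i : ℝ) := Finset.sum_nonneg fun _ _ => Nat.cast_nonneg _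
    rw [abs_mul, abs_mul]
    refine mul_le_mul_of_nonneg_right ?_ (abs_nonneg _)
    rw [abs_of_nonneg (inv_nonneg.2 (hr0 n).le), abs_of_pos (Real.rpow_pos_of_pos (hr0 n) _),
      ← Real.rpow_neg_one]
    exact Real.rpow_le_rpow_of_exponent_le hn (by linarith)
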